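/- Let $d\ge 2$ and let $M$ be a closed (compact, without boundary), connected, Hausdorff $C^\infty$ manifold of dimension $d$. Let $d'\ge 0$ be an integer and $s$ a real number such that either $d'<d-1$ and $s\in[0,1]$, or $d'=d-1$ and $s\in[0,1)$. Here a function on a manifold is of class $C^{d',s}$ if in local coordinates it is of class $C^{d'}$ and its derivatives of order $d'$ are locally Hölder continuous with exponent $s$ (for $s=0$ this means $C^{d'}$). Then there exist a $C^\infty$ Riemannian metric $g$ on $M$, a function $f:M\to\mathbb R$ of class $C^{d',s}$ and of class $C^1$, and a compact connected set $\Lambda_0\subseteq M$ such that $df(q)=0$ for every $q\in\Lambda_0$ while $f$ is not constant on $\Lambda_0$, and such that the Hamiltonian $$H(q,p)=f(q)+\tfrac12|p|^2,\qquad (q,p)\in T^*M,$$ with $|\cdot|$ the norm on covectors induced by $g$, and the set $\Lambda=\{(q,0):q\in\Lambda_0\}$ have the following properties: 1. $H$ is of class $C^{d',s}$ and of class $C^1$ on $T^*M$. 2. $\Lambda$ is compact and connected and is contained in the zero section of $T^*M$, which is a Lagrangian graph (the graph of a one-form that is locally the differential of a $C^2$ function). 3. $\Lambda$ is invariant under the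 Hamiltonian dynamics of $H$: through every point of $\Lambda$ there passes an integral curve $\mathbb R\to T^*M$ of the Hamiltonian vector field $X_H$ that stays in $\Lambda$. If $d\ge 3$, then moreover every integral curve of $X_H$, on any open time interval, that meets $\Lambda$ stays in $\Lambda$. 4. $H$ is not constant on $\Lambda$. -/

import Mathlib

open Set Filter Topology Bundle
open scoped Manifold ContDiff NNReal

noncomputable section

namespace LagrangianGraphs

/-- The model space `ℝ^d`. -/
abbrev Model (d : ℕ) : Type := EuclideanSpace ℝ (Fin d)

/-- The model space `(ℝ^d)^*` of the cotangent fibres. -/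
abbrev CoModel (d : ℕ) : Type := EuclideanSpace ℝ (Fin d) →L[ℝ] ℝ

/-- The cotangent space `T_q^*M`. -/
abbrev CotangentSpace (d : ℕ) {M : Type*} [TopologicalSpace M] [ChartedSpace (Model d) M]
    (q : M) : Type :=
  TangentSpace (𝓡 d) q →L[ℝ] ℝ

/-- The cotangent bundle `T^*M`, with the topology and the manifold structure of the bundle of
continuous linear maps from the tangent bundle to the trivial line bundle. Its points are pairs
`⟨q, p⟩` with `p ∈ T_q^*M`. -/
abbrev CotangentBundle (d : ℕ) (M : Type*) [TopologicalSpace M] [ChartedSpace (Model d) M]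
    [IsManifold (𝓡 d) ∞ M] : Type _ :=
  TotalSpace (CoModel d) (fun q : M => TangentSpace (𝓡 d) q →L[ℝ] ℝ)

/-- The model with corners of `T^*M`, on `ℝ^d × (ℝ^d)^*`. -/
abbrev cotangentModel (d : ℕ) :
    ModelWithCorners ℝ (Model d × CoModel d) (ModelProd (Model d) (CoModel d)) :=
  (𝓡 d).prod 𝓘(ℝ, CoModel d)

/-- `f ∈ C^{k,s}(N, ℝ)` on a manifold `N` without boundary: in local coordinates `f` is of class
`C^k` and its derivative of order `k` is locally Hölder continuous with exponent `s`
(for `s = 0` this is `C^k`, for `s = 1` the `k`-th derivative is locally Lipschitz). -/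
def IsCkHolder {E H N : Type*} [NormedAddCommGroup E] [NormedSpace ℝ E] [TopologicalSpace H]
    (I : ModelWithCorners ℝ E H) [TopologicalSpace N] [ChartedSpace H N]
    (k : ℕ) (s : ℝ≥0) (f : N → ℝ) : Prop :=
  ∀ x : N, ∃ U ∈ 𝓝 (extChartAt I x x),
    ContDiffOn ℝ k (f ∘ (extChartAt I x).symm) U ∧
    ∃ C : ℝ≥0, HolderOnWith C s (iteratedFDeriv ℝ k (f ∘ (extChartAt I x).symm)) U

/-- A positive definite bilinear form on a finite-dimensional space is invertible as a map to the
dual space. -/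
theorem apply_inverse_of_pos {V : Type*} [NormedAddCommGroup V] [NormedSpace ℝ V]
    [FiniteDimensional ℝ V] (B : V →L[ℝ] V →L[ℝ] ℝ) (hB : ∀ v, v ≠ 0 → 0 < B v v)
    (p : V →L[ℝ] ℝ) : B (ContinuousLinearMap.inverse B p) = p := by
  have hinj : Function.Injective (B : V →ₗ[ℝ] V →L[ℝ] ℝ) := by
    rw [← LinearMap.ker_eq_bot, LinearMap.ker_eq_bot']
    intro v hv
    by_contra hne
    have h := hB v hne
    have h0 : B v = 0 := hv
    simp [h0] at h
  have hdim : Module.finrank ℝ V = Module.finrank ℝ (V →L[ℝ] ℝ) :=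
    (Subspace.dual_finrank_eq (K := ℝ) (V := V)).symm.trans
      (LinearMap.toContinuousLinearMap (𝕜 := ℝ) (E := V) (F' := ℝ)).finrank_eq
  let e : V ≃L[ℝ] (V →L[ℝ] ℝ) :=
    (LinearEquiv.ofInjectiveOfFinrankEq _ hinj hdim).toContinuousLinearEquiv
  have he : (e : V →L[ℝ] V →L[ℝ] ℝ) = B := by
    ext v w
    rfl
  rw [← he, ContinuousLinearMap.inverse_equiv]
  exact e.apply_symm_apply p

section

variable {d : ℕ} {M : Type*} [TopologicalSpace M] [ChartedSpace (Model d) M]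
  [IsManifold (𝓡 d) ∞ M]

/-- A `C^∞` Riemannian metric on `M`. -/
abbrev SmoothMetric (d : ℕ) (M : Type*) [TopologicalSpace M] [ChartedSpace (Model d) M]
    [IsManifold (𝓡 d) ∞ M] : Type _ :=
  ContMDiffRiemannianMetric (𝓡 d) ∞ (Model d) (fun q : M => TangentSpace (𝓡 d) q)

/-- The musical isomorphism `p ↦ p^♯`, the inverse of `v ↦ g_q(v, ·)`. -/
def sharp (g : SmoothMetric d M) (q : M) (p : CotangentSpace d q) : TangentSpace (𝓡 d) q :=
  ContinuousLinearMap.inverse (g.inner q) p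

/-- `p^♯` is the vector that represents `p`. -/
theorem inner_sharp (g : SmoothMetric d M) (q : M) (p : CotangentSpace d q) :
    g.inner q (sharp g q p) = p :=
  apply_inverse_of_pos (V := Model d) (g.inner q) (g.pos q) p

/-- The square `|p|²` of the norm of a covector, `|p|² = p(p^♯) = g(p^♯, p^♯)`. -/
def conormSq (g : SmoothMetric d M) (q : M) (p : CotangentSpace d q) : ℝ :=
  p (sharp g q p)

/-- The Hamiltonian `H(q, p) = f(q) + |p|²/2`. -/
def mechanicalHamiltonian (g : SmoothMetric d M) (f : M → ℝ) (x : CotangentBundle d M) : ℝ :=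
  f x.proj + conormSq g x.proj x.snd / 2

/-- The Hamiltonian vector field `X_H` on `T^*M`, given by Hamilton's equations
`dq_i/dt = ∂H/∂p_i`, `dp_i/dt = -∂H/∂q_i`. The tangent space of `T^*M` at `x` is `ℝ^d × (ℝ^d)^*`,
read in the canonical coordinates `(q, p)` that the preferred chart of `M` at the base point of `x`
induces on `T^*M`. -/
def hamiltonianVectorField (H : CotangentBundle d M → ℝ) (x : CotangentBundle d M) :
    TangentSpace (cotangentModel d) x :=
  let dH : Model d × CoModel d →L[ℝ] ℝ := mfderiv (cotangentModel d) 𝓘(ℝ, ℝ) H x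
  ((WithLp.toLp 2 fun i : Fin d => dH (0, EuclideanSpace.proj i),
    -(dH.comp (ContinuousLinearMap.inl ℝ (Model d) (CoModel d)))) : Model d × CoModel d)

/-- Invariance of `Λ` under the Hamiltonian dynamics of `H`: each point of `Λ` lies on an
orbit, defined for all times, that stays in `Λ`. When `X_H` generates a flow this is invariance
under the flow; it makes sense also for an `X_H` that is only continuous. -/
def IsInvariant (H : CotangentBundle d M → ℝ) (Λ : Set (CotangentBundle d M)) : Prop :=
  ∀ x ∈ Λ, ∃ γ : ℝ → CotangentBundle d M,
    γ 0 = x ∧ IsMIntegralCurve (I := cotangentModel d) γ (hamiltonianVectorField H) ∧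
      ∀ t, γ t ∈ Λ

/-- Every orbit of `X_H`, on whatever open time interval, that meets `Λ` stays in `Λ`. -/
def ContainsItsOrbits (H : CotangentBundle d M → ℝ) (Λ : Set (CotangentBundle d M)) : Prop :=
  ∀ (γ : ℝ → CotangentBundle d M) (a b : ℝ),
    IsMIntegralCurveOn (I := cotangentModel d) γ (hamiltonianVectorField H) (Ioo a b) →
    ∀ t₀ ∈ Ioo a b, γ t₀ ∈ Λ → ∀ t ∈ Ioo a b, γ t ∈ Λ

/-- The graph `{(q, Γ(q))}` of a one-form `Γ`, as a subset of `T^*M`. -/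
def graph (Γ : (q : M) → CotangentSpace d q) : Set (CotangentBundle d M) :=
  {x | x.snd = Γ x.proj}

/-- The graph of the one-form `Γ` is a (`C^1`) Lagrangian graph: locally, `Γ` is the
differential of a function of class `C^2`. -/
def IsLagrangianGraph (Γ : (q : M) → CotangentSpace d q) : Prop :=
  ∀ q : M, ∃ U : Set M, IsOpen U ∧ q ∈ U ∧ ∃ u : M → ℝ,
    ContMDiffOn (𝓡 d) 𝓘(ℝ, ℝ) 2 u U ∧ ∀ x ∈ U, Γ x = mfderiv (𝓡 d) 𝓘(ℝ, ℝ) u x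

/-- A Whitney–Norton pair: `f` is `C^1`, `Λ₀` is a compact connected set of critical points
of `f`, and `f` is not constant on `Λ₀`. -/
structure IsWhitneyNorton (d : ℕ) {M : Type*} [TopologicalSpace M] [ChartedSpace (Model d) M]
    (f : M → ℝ) (Λ₀ : Set M) : Prop where
  contMDiff : ContMDiff (𝓡 d) 𝓘(ℝ, ℝ) 1 f
  isCompact : IsCompact Λ₀
  isConnected : IsConnected Λ₀
  critical : ∀ q ∈ Λ₀, mfderiv (𝓡 d) 𝓘(ℝ, ℝ) f q = 0
  not_constant : ∃ q₁ ∈ Λ₀, ∃ q₂ ∈ Λ₀, f q₁ ≠ f q₂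

end

end LagrangianGraphs

end

/-! A $C^d$ function on a $d$-manifold is constant on connected sets of critical points, by Sard's
theorem. Below order $d$ this fails (Whitney, Norton), and the Hamiltonian is built from such a
failure. Fix an exponent β with max(d' + s, d - 1) < β < d; then β > 1 because d ≥ 2.

The fractal. Put μ = 2^(-1/β). The box with sides 1, μ, ..., μ^(d-1), contracted by μ and with its
coordinates rotated cyclically, becomes a box with first side μ^d and the other sides unchanged.
Since β < d, μ^d < 1/2, so two such copies fit in the box with a gap between them. Joining them by a
segment and iterating gives a compact connected K. The height v that gains a binary digit at each
subdivision and is constant on the segments goes from 0 to 1 on K. As μ^β = 1/2, a subdivision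
halves both increments of v and β-th powers of distances, so v is β-Hölder on K
(`BoxSplitting.exists_holder_height`).

The flat extension. As β > 1, v extends to F on ℝ^d with dF = 0 on K (`exists_flat_extension`). F is
a series whose n-th term has i-th derivatives of size 2^((i-β)n). Hence F is of class C^{d',s},
because d' + s < β, and of class C^{d-1}, because d - 1 < β. The series bounds survive smooth
substitutions, so regularity passes through charts to M and to T^*M.

The dynamics. F is copied into a chart of M as f, and K becomes Λ₀. Over Λ₀ the zero section
consists of zeros of X_H, hence is invariant, while H = f is not constant there. For d ≥ 3, f is C².
An orbit through a rest point (q₀, 0) has |p|² = 2(f(q₀) - f(q)), which near q₀ is at most a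
constant times the squared distance to q₀; the speed of q is then bounded by that distance and
Grönwall's inequality makes the orbit constant (`containsItsOrbits_mechanicalHamiltonian`). -/

noncomputable section

namespace LagrangianGraphs

/-! ### Hölder regularity of series with dyadic derivative bounds -/

section DyadicSeries

theorem holderOnWith_of_dist_le {X Y : Type*} [PseudoMetricSpace X] [PseudoMetricSpace Y]
    {f : X → Y} {U : Set X} {C s : ℝ≥0}
    (h : ∀ x ∈ U, ∀ y ∈ U, dist (f x) (f y) ≤ C * dist x y ^ (s : ℝ)) : HolderOnWith C s f U := by
  intro x hx y hy
  rw [edist_dist, edist_dist, ENNReal.ofReal_rpow_of_nonneg (p := (s : ℝ)) dist_nonneg s.coe_nonneg,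
    ← ENNReal.ofReal_coe_nnreal, ← ENNReal.ofReal_mul C.coe_nonneg]
  exact ENNReal.ofReal_le_ofReal (h x hx y hy)

variable {E E' G : Type*} [NormedAddCommGroup E] [NormedSpace ℝ E] [NormedAddCommGroup E']
  [NormedSpace ℝ E'] [NormedAddCommGroup G] [NormedSpace ℝ G]

/-- `f` is of class `C^{k,s}` on a neighbourhood of `x`. -/
def CkHolderAt (k : ℕ) (s : ℝ≥0) (f : E → ℝ) (x : E) : Prop :=
  ∃ U ∈ 𝓝 x, ContDiffOn ℝ k f U ∧ ∃ C : ℝ≥0, HolderOnWith C s (iteratedFDeriv ℝ k f) U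

theorem CkHolderAt.congr {k : ℕ} {s : ℝ≥0} {f g : E → ℝ} {x : E} (hf : CkHolderAt k s f x)
    (h : g =ᶠ[𝓝 x] f) : CkHolderAt k s g x := by
  obtain ⟨U, hU, hc, C, hC⟩ := hf
  obtain ⟨V, hV, hVo, hxV⟩ := eventually_nhds_iff.1 h
  refine ⟨U ∩ V, inter_mem hU (hVo.mem_nhds hxV), (hc.mono inter_subset_left).congr
    fun y hy => hV y hy.2, C, ?_⟩
  have key : ∀ y ∈ U ∩ V, iteratedFDeriv ℝ k g y = iteratedFDeriv ℝ k f y := fun y hy =>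
    (EventuallyEq.iteratedFDeriv ℝ (eventually_nhds_iff.2 ⟨V, hV, hVo, hy.2⟩ :
      g =ᶠ[𝓝 y] f) k).eq_of_nhds
  intro y hy z hz
  rw [key y hy, key z hz]
  exact hC y hy.1 z hz.1

theorem CkHolderAt.add {k : ℕ} {s : ℝ≥0} {f g : E → ℝ} {x : E} (hf : CkHolderAt k s f x)
    (hg : CkHolderAt k s g x) : CkHolderAt k s (fun y => f y + g y) x := by
  obtain ⟨U, hU, hc, C, hC⟩ := hf
  obtain ⟨V, hV, hc', C', hC'⟩ := hg
  have hUV : interior (U ∩ V) ⊆ U ∩ V := interior_subset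
  refine ⟨interior (U ∩ V), interior_mem_nhds.2 (inter_mem hU hV),
    (hc.mono (hUV.trans inter_subset_left)).add (hc'.mono (hUV.trans inter_subset_right)),
    C + C', ?_⟩
  have key : ∀ y ∈ interior (U ∩ V), iteratedFDeriv ℝ k (fun y => f y + g y) y =
      iteratedFDeriv ℝ k f y + iteratedFDeriv ℝ k g y := fun y hy => by
    have h := mem_interior_iff_mem_nhds.1 hy
    exact fun_iteratedFDeriv_add_apply (hc.contDiffAt (mem_of_superset h inter_subset_left))
      (hc'.contDiffAt (mem_of_superset h inter_subset_right))
  intro y hy z hz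
  rw [key y hy, key z hz]
  refine (edist_add_add_le _ _ _ _).trans ?_
  push_cast
  rw [add_mul]
  exact add_le_add (hC y (hUV hy).1 z (hUV hz).1) (hC' y (hUV hy).2 z (hUV hz).2)

/-- The `k`-th derivative is Lipschitz near `x`, and on a set of diameter at most 2 a Lipschitz map
is Hölder of every exponent `s ≤ 1`. -/
theorem _root_.ContDiffAt.ckHolderAt {k : ℕ} {s : ℝ≥0} (hs : s ≤ 1) {f : E → ℝ} {x : E}
    (hf : ContDiffAt ℝ (k + 1 : ℕ) f x) : CkHolderAt k s f x := by
  obtain ⟨U, hU, hc⟩ := (hf.of_le (by exact_mod_cast k.le_succ) :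
    ContDiffAt ℝ k f x).contDiffOn le_rfl (by simp)
  have h1 : ContDiffAt ℝ 1 (iteratedFDeriv ℝ k f) x :=
    hf.iteratedFDeriv_right (by push_cast; rw [add_comm])
  obtain ⟨K, t, ht, hL⟩ := h1.exists_lipschitzOnWith
  refine ⟨U ∩ (t ∩ Metric.ball x 1), inter_mem (by simpa using hU)
    (inter_mem ht (Metric.ball_mem_nhds x one_pos)), (hc.mono inter_subset_left), ?_⟩
  have h2 : HolderOnWith K 1 (iteratedFDeriv ℝ k f) (U ∩ (t ∩ Metric.ball x 1)) :=
    holderOnWith_one.2 (hL.mono fun y hy => hy.2.1)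
  refine ⟨_, h2.of_le (D := 2) (fun y hy z hz => ?_) hs⟩
  rw [edist_dist]
  refine ENNReal.ofReal_le_of_le_toReal ?_
  have h3 := dist_triangle_right y z x
  have h4 := Metric.mem_ball.1 hy.2.2
  have h5 := Metric.mem_ball.1 hz.2.2
  simp
  linarith

/-- `F` is the sum of a series of smooth functions whose `n`-th term has derivatives of order
`i ≤ N` of size at most `2^{ni} q^n`. -/
def IsDyadicSeries (q : ℝ) (N : ℕ) (F : E → ℝ) : Prop :=
  ∃ (u : ℕ → E → ℝ) (A : ℝ), (∀ n, ContDiff ℝ ∞ (u n)) ∧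
    (∀ n, ∀ i ≤ N, ∀ x, ‖iteratedFDeriv ℝ i (u n) x‖ ≤ A * (2 ^ i * q) ^ n) ∧
    ∀ x, F x = ∑' n, u n x

/-- The bounds `A * (2 ^ i * q) ^ n` increase with `i`, so in the formula of Faà di Bruno all lower
derivatives obey the bound of order `i`, and only a factor independent of `n` is lost. Substituting
term by term replaces a chain rule for Hölder functions. -/
theorem IsDyadicSeries.comp {q : ℝ} (hq : 0 ≤ q) {N : ℕ} {F : E → ℝ} (hF : IsDyadicSeries q N F)
    {h : E' → E} (hh : ContDiff ℝ ∞ h) {D : ℝ} (hD0 : 0 ≤ D)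
    (hD : ∀ i, 1 ≤ i → i ≤ N → ∀ x, ‖iteratedFDeriv ℝ i h x‖ ≤ D ^ i) :
    IsDyadicSeries q N (F ∘ h) := by
  obtain ⟨u, A, hu, hA, hF⟩ := hF
  have hA0 : 0 ≤ A := by simpa using (norm_nonneg _).trans (hA 0 0 (Nat.zero_le _) (h 0))
  refine ⟨fun n => u n ∘ h, (N.factorial : ℝ) * A * (max 1 D) ^ N,
    fun n => (hu n).comp hh, fun n i hi x => ?_, fun x => hF _⟩
  have h1 := norm_iteratedFDeriv_comp_le (hu n) hh (by exact_mod_cast le_top) x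
    (n := i) (C := A * (2 ^ i * q) ^ n) (D := max 1 D) (fun j hj => (hA n j (hj.trans hi) _).trans ?_)
    (fun j hj1 hj => ?_)
  · refine h1.trans ?_
    have h2 : (i.factorial : ℝ) ≤ N.factorial := by exact_mod_cast Nat.factorial_le hi
    have h3 : (max 1 D) ^ i ≤ (max 1 D) ^ N := pow_le_pow_right₀ (le_max_left _ _) hi
    have h4 : 0 ≤ A * (2 ^ i * q) ^ n := by positivity
    calc (i.factorial : ℝ) * (A * (2 ^ i * q) ^ n) * max 1 D ^ i
        ≤ N.factorial * (A * (2 ^ i * q) ^ n) * max 1 D ^ N := by gcongr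
      _ = _ := by ring
  · gcongr
    norm_num
  · refine (hD j hj1 (hj.trans hi) x).trans ?_
    gcongr
    exact le_max_right _ _

/-- Cutting off `h - h x` outside a small ball makes all derivatives bounded, as
`IsDyadicSeries.comp` requires; only the germ at `x` matters. -/
theorem exists_contDiff_eventuallyEq_bounded [FiniteDimensional ℝ E'] {h : E' → E} {U : Set E'}
    {x : E'} (hU : U ∈ 𝓝 x) (hh : ContDiffOn ℝ ∞ h U) (N : ℕ) :
    ∃ (g : E' → E) (D : ℝ), ContDiff ℝ ∞ g ∧ g =ᶠ[𝓝 x] h ∧ 0 ≤ D ∧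
      ∀ i, 1 ≤ i → i ≤ N → ∀ y, ‖iteratedFDeriv ℝ i g y‖ ≤ D ^ i := by
  obtain ⟨r, hr, hrU⟩ := Metric.mem_nhds_iff.1 hU
  let χ : ContDiffBump x := ⟨r / 4, r / 2, by positivity, by linarith⟩
  let w : E' → E := fun y => χ y • (h y - h x)
  have hsub : Metric.closedBall x (r / 2) ⊆ Metric.ball x r :=
    Metric.closedBall_subset_ball (by linarith)
  have hts : tsupport w ⊆ Metric.closedBall x (r / 2) := by
    refine (tsupport_smul_subset_left χ _).trans ?_
    rw [χ.tsupport_eq]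
  have hw : ContDiff ℝ ∞ w := by
    rw [contDiff_iff_contDiffAt]
    intro y
    by_cases hy : y ∈ tsupport w
    · have hy' : U ∈ 𝓝 y :=
        mem_of_superset (Metric.isOpen_ball.mem_nhds (hsub (hts hy))) hrU
      exact χ.contDiffAt.smul ((hh.contDiffAt hy').sub contDiffAt_const)
    · refine (contDiffAt_const (c := (0 : E))).congr_of_eventuallyEq ?_
      exact notMem_tsupport_iff_eventuallyEq.1 hy
  have hcs : HasCompactSupport w :=
    (isCompact_closedBall x (r / 2)).of_isClosed_subset (isClosed_tsupport _) hts
  have hb : ∀ i : ℕ, ∃ C, ∀ y, ‖iteratedFDeriv ℝ i w y‖ ≤ C := fun i =>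
    (hw.continuous_iteratedFDeriv (by exact_mod_cast le_top)).bounded_above_of_compact_support
      (hcs.iteratedFDeriv i)
  choose C hC using hb
  have hC0 : ∀ i, 0 ≤ C i := fun i => (norm_nonneg _).trans (hC i 0)
  -- Since `1 ≤ D` and `C i ≤ D`, also `C i ≤ D ^ i` for `i ≥ 1`.
  let D := 1 + ∑ i ∈ Finset.range (N + 1), C i
  have hD1 : 1 ≤ D := le_add_of_nonneg_right (Finset.sum_nonneg fun i _ => hC0 i)
  refine ⟨fun y => w y + h x, D, hw.add contDiff_const, ?_, zero_le_one.trans hD1,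
    fun i hi hiN y => ?_⟩
  · filter_upwards [χ.eventuallyEq_one] with y hy
    simp [w, hy]
  · rw [fun_iteratedFDeriv_add_apply (hw.contDiffAt.of_le (by exact_mod_cast le_top))
      contDiffAt_const, iteratedFDeriv_const_of_ne (by omega)]
    simp only [Pi.zero_apply, add_zero]
    refine (hC i y).trans ?_
    have h1 : C i ≤ ∑ i ∈ Finset.range (N + 1), C i :=
      Finset.single_le_sum (fun j _ => hC0 j) (Finset.mem_range.2 (by omega))
    exact (h1.trans (by simp [D])).trans (le_self_pow₀ hD1 (by omega))

theorem IsDyadicSeries.contDiff {q : ℝ} (hq : 0 ≤ q) {N k : ℕ} {F : E → ℝ}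
    (hF : IsDyadicSeries q N F) (hk : k ≤ N) (hkq : 2 ^ k * q < 1) : ContDiff ℝ k F := by
  obtain ⟨u, A, hu, hA, hF⟩ := hF
  rw [funext hF]
  have h := contDiff_tsum (𝕜 := ℝ) (N := (k : ℕ∞)) (f := u) (v := fun i n => A * (2 ^ i * q) ^ n)
    (fun n => (hu n).of_le (by exact_mod_cast le_top)) (fun i hi => ?_)
    (fun i n x hi => hA n i ((Nat.cast_le.1 hi).trans hk) x)
  · exact_mod_cast h
  · refine (summable_geometric_of_lt_one (by positivity) (lt_of_le_of_lt ?_ hkq)).mul_left A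
    gcongr
    · norm_num
    · exact_mod_cast hi

/-- Interpolation: the size of the `k`-th derivative and the mean value theorem bound the increment
of the `n`-th term by `2 * A * (2 ^ k * q) ^ n * min 1 t` with `t = 2 ^ n * dist x y`. Since `min 1
t ≤ t ^ s`, the increments sum to a geometric series of ratio `2 ^ k * 2 ^ s * q`. -/
theorem IsDyadicSeries.iteratedFDeriv_sub_le {q : ℝ} (hq : 0 ≤ q) {N k : ℕ} {s : ℝ≥0} {F : E → ℝ}
    (hF : IsDyadicSeries q N F) (hk : k + 1 ≤ N) (hs : s ≤ 1)
    (hkq : 2 ^ k * 2 ^ (s : ℝ) * q < 1) :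
    ∃ C : ℝ≥0, ∀ x y, dist (iteratedFDeriv ℝ k F x) (iteratedFDeriv ℝ k F y) ≤
      C * dist x y ^ (s : ℝ) := by
  obtain ⟨u, A, hu, hA, hF⟩ := hF
  have hA0 : 0 ≤ A := by simpa using (norm_nonneg _).trans (hA 0 0 (Nat.zero_le _) 0)
  have h2s : (1 : ℝ) ≤ 2 ^ (s : ℝ) := Real.one_le_rpow (by norm_num) s.2
  have hkq' : 2 ^ k * q < 1 := by
    refine lt_of_le_of_lt ?_ hkq
    gcongr
    exact le_mul_of_one_le_right (by positivity) h2s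
  have hsum : ∀ i ≤ k, Summable fun n => A * (2 ^ i * q) ^ n := fun i hi => by
    refine (summable_geometric_of_lt_one (by positivity) (lt_of_le_of_lt ?_ hkq')).mul_left A
    gcongr
    norm_num
  have hD : ∀ x, iteratedFDeriv ℝ k F x = ∑' n, iteratedFDeriv ℝ k (u n) x := fun x => by
    rw [funext hF]
    exact iteratedFDeriv_tsum_apply (𝕜 := ℝ) (N := (k : ℕ∞)) (f := u)
      (v := fun i n => A * (2 ^ i * q) ^ n)
      (fun n => (hu n).of_le (by exact_mod_cast le_top)) (fun i hi => hsum i (Nat.cast_le.1 hi))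
      (fun i n x hi => hA n i ((Nat.cast_le.1 hi).trans (by omega)) x) le_rfl x
  have hSum : ∀ x, Summable fun n => iteratedFDeriv ℝ k (u n) x := fun x =>
    .of_norm_bounded (hsum k le_rfl) fun n => hA n k (by omega) x
  have hterm : ∀ n x y, ‖iteratedFDeriv ℝ k (u n) x - iteratedFDeriv ℝ k (u n) y‖ ≤
      2 * A * dist x y ^ (s : ℝ) * (2 ^ k * 2 ^ (s : ℝ) * q) ^ n := fun n x y => by
    have b1 : ‖iteratedFDeriv ℝ k (u n) x - iteratedFDeriv ℝ k (u n) y‖ ≤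
        2 * A * (2 ^ k * q) ^ n := by
      refine (norm_sub_le _ _).trans ?_
      linarith [hA n k (by omega) x, hA n k (by omega) y]
    have b2 : ‖iteratedFDeriv ℝ k (u n) x - iteratedFDeriv ℝ k (u n) y‖ ≤
        A * (2 ^ (k + 1) * q) ^ n * ‖x - y‖ := by
      refine Convex.norm_image_sub_le_of_norm_fderiv_le (𝕜 := ℝ) (s := univ)
        (fun z _ => ?_) (fun z _ => ?_) convex_univ (mem_univ y) (mem_univ x)
      · exact ((hu n).differentiable_iteratedFDeriv (by exact_mod_cast WithTop.coe_lt_top _)) z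
      · rw [norm_fderiv_iteratedFDeriv]
        exact hA n (k + 1) hk z
    have e2 : (2 ^ k * 2 ^ (s : ℝ) * q) ^ n = (2 ^ k * q) ^ n * ((2 : ℝ) ^ n) ^ (s : ℝ) := by
      rw [← Real.rpow_natCast 2 n, ← Real.rpow_mul (by norm_num), mul_comm (n : ℝ),
        Real.rpow_mul (by norm_num), Real.rpow_natCast]
      ring
    have e3 : 2 * A * dist x y ^ (s : ℝ) * (2 ^ k * 2 ^ (s : ℝ) * q) ^ n =
        2 * A * (2 ^ k * q) ^ n * (2 ^ n * dist x y) ^ (s : ℝ) := by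
      rw [e2, Real.mul_rpow (by positivity) dist_nonneg]
      ring
    rw [e3]
    rcases le_total 1 (2 ^ n * dist x y) with h | h
    · exact b1.trans (le_mul_of_one_le_right (by positivity) (Real.one_le_rpow h s.2))
    · refine b2.trans ?_
      have h' : 2 ^ n * dist x y ≤ (2 ^ n * dist x y) ^ (s : ℝ) := by
        conv_lhs => rw [← Real.rpow_one (2 ^ n * dist x y)]
        exact Real.rpow_le_rpow_of_exponent_ge' (by positivity) h s.2 hs
      calc A * (2 ^ (k + 1) * q) ^ n * ‖x - y‖ = A * (2 ^ k * q) ^ n * (2 ^ n * dist x y) := by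
            rw [dist_eq_norm]; ring
        _ ≤ 2 * A * (2 ^ k * q) ^ n * (2 ^ n * dist x y) ^ (s : ℝ) := by
            have : 0 ≤ A * (2 ^ k * q) ^ n := by positivity
            have h3 : 0 ≤ (2 ^ n * dist x y) ^ (s : ℝ) := by positivity
            nlinarith
  have hg : Summable fun n => (2 ^ k * 2 ^ (s : ℝ) * q) ^ n :=
    summable_geometric_of_lt_one (by positivity) hkq
  refine ⟨NNReal.mk (2 * A * ∑' n, (2 ^ k * 2 ^ (s : ℝ) * q) ^ n)
    (mul_nonneg (by positivity) (tsum_nonneg fun n => by positivity)), fun x y => ?_⟩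
  rw [dist_eq_norm, hD, hD, ← (hSum x).tsum_sub (hSum y)]
  refine (tsum_of_norm_bounded (hg.mul_left (2 * A * dist x y ^ (s : ℝ))).hasSum
    fun n => hterm n x y).trans (le_of_eq ?_)
  rw [tsum_mul_left, NNReal.coe_mk]
  ring

theorem IsDyadicSeries.ckHolderAt {q : ℝ} (hq : 0 ≤ q) {N k : ℕ} {s : ℝ≥0} {F : E → ℝ}
    (hF : IsDyadicSeries q N F) (hk : k + 1 ≤ N) (hs : s ≤ 1)
    (hkq : 2 ^ k * 2 ^ (s : ℝ) * q < 1) (x : E) : CkHolderAt k s F x := by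
  obtain ⟨C, hC⟩ := hF.iteratedFDeriv_sub_le hq hk hs hkq
  refine ⟨univ, univ_mem, (hF.contDiff hq (by omega) (lt_of_le_of_lt ?_ hkq)).contDiffOn, C,
    holderOnWith_of_dist_le fun y _ z _ => hC y z⟩
  gcongr
  exact le_mul_of_one_le_right (by positivity) (Real.one_le_rpow (by norm_num) s.2)

theorem IsDyadicSeries.ckHolderAt_comp [FiniteDimensional ℝ E'] {q : ℝ} (hq : 0 ≤ q) {N k : ℕ}
    {s : ℝ≥0} {F : E → ℝ} (hF : IsDyadicSeries q N F) (hk : k + 1 ≤ N) (hs : s ≤ 1)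
    (hkq : 2 ^ k * 2 ^ (s : ℝ) * q < 1) {h : E' → E} {U : Set E'} {x : E'} (hU : U ∈ 𝓝 x)
    (hh : ContDiffOn ℝ ∞ h U) : CkHolderAt k s (F ∘ h) x := by
  obtain ⟨g, D, hg, hgh, hD0, hD⟩ := exists_contDiff_eventuallyEq_bounded hU hh N
  exact ((hF.comp hq hg hD0 hD).ckHolderAt hq hk hs hkq x).congr
    (hgh.symm.fun_comp F)

end DyadicSeries

/-! ### A connected fractal with a non-constant Hölder height -/

section Fractal

/-- A separation of the intersection extends to disjoint open sets, and by compactness their union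
already contains some `K n`, which would then be separated too. -/
theorem isPreconnected_iInter_of_antitone {X : Type*} [TopologicalSpace X] [T2Space X]
    {K : ℕ → Set X} (hK : Antitone K) (hc : ∀ n, IsCompact (K n))
    (hp : ∀ n, IsPreconnected (K n)) : IsPreconnected (⋂ n, K n) := by
  have hcomp : IsCompact (⋂ n, K n) :=
    (hc 0).of_isClosed_subset (isClosed_iInter fun n => (hc n).isClosed) (iInter_subset _ 0)
  rw [isPreconnected_closed_iff]
  intro a b ha hb hab hna hnb
  by_contra hne
  have hdis : Disjoint ((⋂ n, K n) ∩ a) ((⋂ n, K n) ∩ b) := by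
    rw [Set.disjoint_left]
    intro x hx hy
    exact hne ⟨x, hx.1, hx.2, hy.2⟩
  obtain ⟨U, V, hU, hV, haU, hbV, hUV⟩ :=
    SeparatedNhds.of_isCompact_isCompact (hcomp.inter_right ha) (hcomp.inter_right hb) hdis
  obtain ⟨n, hn⟩ := exists_subset_nhds_of_isCompact (U := U ∪ V) (V := K)
    (hK.directed_ge) hc fun x hx => by
      refine (hU.union hV).mem_nhds ?_
      rcases hab hx with h | h
      · exact Or.inl (haU ⟨hx, h⟩)
      · exact Or.inr (hbV ⟨hx, h⟩)
  obtain ⟨x, hx⟩ := hna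
  obtain ⟨y, hy⟩ := hnb
  obtain ⟨z, -, hzU, hzV⟩ := hp n U V hU hV hn ⟨x, mem_iInter.1 hx.1 n, haU hx⟩
    ⟨y, mem_iInter.1 hy.1 n, hbV hy⟩
  exact Set.disjoint_left.1 hUV hzU hzV

/-- For `D` with values in `[0, 1]` and any map `T`, the binary expansion whose digits are read
along the orbits of `T`. -/
theorem exists_binary_coding {X : Type*} (D : X → ℝ) (hD0 : ∀ x, 0 ≤ D x) (hD1 : ∀ x, D x ≤ 1)
    (T : X → X) :
    ∃ v : X → ℝ, (∀ x, 0 ≤ v x) ∧ (∀ x, v x ≤ 1) ∧ ∀ x, v x = (D x + v (T x)) / 2 := by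
  have hg : HasSum (fun n : ℕ => (1 / 2 : ℝ) ^ n / 2) 1 := by
    have := (hasSum_geometric_two).div_const 2
    simpa using this
  have hle : ∀ x n, D (T^[n] x) * ((1 / 2 : ℝ) ^ n / 2) ≤ (1 / 2 : ℝ) ^ n / 2 := fun x n =>
    mul_le_of_le_one_left (by positivity) (hD1 _)
  have hnn : ∀ x n, 0 ≤ D (T^[n] x) * ((1 / 2 : ℝ) ^ n / 2) := fun x n =>
    mul_nonneg (hD0 _) (by positivity)
  have hs : ∀ x, Summable fun n => D (T^[n] x) * ((1 / 2 : ℝ) ^ n / 2) := fun x =>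
    Summable.of_nonneg_of_le (hnn x) (hle x) hg.summable
  refine ⟨fun x => ∑' n, D (T^[n] x) * ((1 / 2 : ℝ) ^ n / 2), fun x => tsum_nonneg (hnn x),
    fun x => ?_, fun x => ?_⟩
  · exact ((hs x).tsum_le_tsum (hle x) hg.summable).trans hg.tsum_eq.le
  · dsimp only
    rw [(hs x).tsum_eq_zero_add, add_div, ← tsum_div_const]
    congr 1
    · simp
      ring
    · refine tsum_congr fun n => ?_
      rw [Function.iterate_succ_apply]
      ring

variable {E : Type*} [NormedAddCommGroup E] [NormedSpace ℝ E]

/-- A convex body `B` with opposite corners `0` and `c` and two similarities `x ↦ μ R x` and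
`x ↦ (1 - lam) e + μ R x` that map `B` onto two parts of `B` separated by the slab
`lam < ℓ < 1 - lam`. -/
structure BoxSplitting (E : Type*) [NormedAddCommGroup E] [NormedSpace ℝ E] where
  R : E ≃ₗᵢ[ℝ] E
  ℓ : E →L[ℝ] ℝ
  e : E
  c : E
  μ : ℝ
  lam : ℝ
  B : Set E
  μ_pos : 0 < μ
  lam_pos : 0 < lam
  lam_lt : lam < 1 / 2
  ℓ_le : ∀ x, |ℓ x| ≤ ‖x‖
  ℓ_e : ℓ e = 1
  isCompact_B : IsCompact B
  convex_B : Convex ℝ B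
  zero_mem : 0 ∈ B
  c_mem : c ∈ B
  left_mem : ∀ x ∈ B, μ • R x ∈ B
  right_mem : ∀ x ∈ B, (1 - lam) • e + μ • R x ∈ B
  nonneg_ℓ : ∀ x ∈ B, 0 ≤ μ * ℓ (R x)
  ℓ_le_lam : ∀ x ∈ B, μ * ℓ (R x) ≤ lam
  c_fixed : (1 - lam) • e + μ • R c = c
  ℓ_c : μ * ℓ (R c) = lam

namespace BoxSplitting

variable (Q : BoxSplitting E)

/-- The similarity onto the left part. -/
def left (x : E) : E := Q.μ • Q.R x

/-- The similarity onto the right part. -/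
def right (x : E) : E := (1 - Q.lam) • Q.e + Q.μ • Q.R x

/-- The inverse of `left`. -/
def leftInv (x : E) : E := Q.R.symm (Q.μ⁻¹ • x)

/-- The inverse of `right`. -/
def rightInv (x : E) : E := Q.R.symm (Q.μ⁻¹ • (x - (1 - Q.lam) • Q.e))

theorem leftInv_left (x : E) : Q.leftInv (Q.left x) = x := by
  simp [leftInv, left, smul_smul, inv_mul_cancel₀ Q.μ_pos.ne']

theorem rightInv_right (x : E) : Q.rightInv (Q.right x) = x := by
  simp [rightInv, right, smul_smul, inv_mul_cancel₀ Q.μ_pos.ne']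

theorem norm_left_sub (x y : E) : ‖Q.left x - Q.left y‖ = Q.μ * ‖x - y‖ := by
  rw [left, left, ← smul_sub, ← map_sub, norm_smul, Q.R.norm_map, Real.norm_of_nonneg Q.μ_pos.le]

theorem norm_right_sub (x y : E) : ‖Q.right x - Q.right y‖ = Q.μ * ‖x - y‖ := by
  rw [right, right, add_sub_add_left_eq_sub]
  exact Q.norm_left_sub x y

theorem continuous_left : Continuous Q.left := Q.R.continuous.const_smul _

theorem continuous_right : Continuous Q.right :=
  continuous_const.add (Q.R.continuous.const_smul _)

theorem left_zero : Q.left 0 = 0 := by simp [left]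

theorem right_c : Q.right Q.c = Q.c := Q.c_fixed

theorem ℓ_left (x : E) : Q.ℓ (Q.left x) = Q.μ * Q.ℓ (Q.R x) := by simp [left]

theorem ℓ_right (x : E) : Q.ℓ (Q.right x) = 1 - Q.lam + Q.μ * Q.ℓ (Q.R x) := by
  simp [right, Q.ℓ_e]

/-- The segment that joins the last point of the left part to the first point of the right
part. -/
def bridge : Set E := segment ℝ (Q.left Q.c) (Q.right 0)

/-- `ℓ` parametrizes the bridge affinely across the slab, so distances along it are controlled by
differences of `ℓ`. -/
theorem exists_of_mem_bridge {x : E} (hx : x ∈ Q.bridge) : ∃ t : ℝ, 0 ≤ t ∧ t ≤ 1 ∧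
    x - Q.left Q.c = t • (Q.right 0 - Q.left Q.c) ∧ Q.ℓ x = Q.lam + t * (1 - 2 * Q.lam) := by
  rw [bridge, segment_eq_image'] at hx
  obtain ⟨t, ⟨h0, h1⟩, rfl⟩ := hx
  refine ⟨t, h0, h1, by simp, ?_⟩
  simp only [map_add, map_smul, map_sub, ℓ_left, ℓ_right, Q.ℓ_c, map_zero, mul_zero, smul_eq_mul]
  ring

/-- The stages of the construction of the fractal. -/
def stage : ℕ → Set E
  | 0 => Q.B
  | n + 1 => (Q.left '' stage n ∪ Q.bridge) ∪ Q.right '' stage n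

theorem zero_mem_stage : ∀ n, (0 : E) ∈ Q.stage n
  | 0 => Q.zero_mem
  | n + 1 => Or.inl (Or.inl ⟨0, zero_mem_stage n, Q.left_zero⟩)

theorem c_mem_stage : ∀ n, Q.c ∈ Q.stage n
  | 0 => Q.c_mem
  | n + 1 => Or.inr ⟨Q.c, c_mem_stage n, Q.right_c⟩

theorem bridge_subset : Q.bridge ⊆ Q.B :=
  Q.convex_B.segment_subset (Q.left_mem _ Q.c_mem) (Q.right_mem _ Q.zero_mem)

theorem stage_succ_subset : ∀ n, Q.stage (n + 1) ⊆ Q.stage n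
  | 0 => by
    rintro x ((⟨y, hy, rfl⟩ | hx) | ⟨y, hy, rfl⟩)
    · exact Q.left_mem y hy
    · exact Q.bridge_subset hx
    · exact Q.right_mem y hy
  | n + 1 => union_subset_union (union_subset_union (image_mono (stage_succ_subset n)) le_rfl)
      (image_mono (stage_succ_subset n))

theorem antitone_stage : Antitone Q.stage := antitone_nat_of_succ_le Q.stage_succ_subset

theorem stage_subset (n : ℕ) : Q.stage n ⊆ Q.B := Q.antitone_stage (Nat.zero_le n)

theorem isCompact_stage : ∀ n, IsCompact (Q.stage n)
  | 0 => Q.isCompact_B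
  | n + 1 => (((isCompact_stage n).image Q.continuous_left).union (by
      rw [bridge, segment_eq_image_lineMap]
      exact isCompact_Icc.image (AffineMap.lineMap_continuous))).union
      ((isCompact_stage n).image Q.continuous_right)

theorem isPreconnected_stage : ∀ n, IsPreconnected (Q.stage n)
  | 0 => Q.convex_B.isPreconnected
  | n + 1 => by
    have h := isPreconnected_stage n
    refine IsPreconnected.union (Q.right 0) (Or.inr (right_mem_segment ℝ _ _))
      ⟨0, Q.zero_mem_stage n, rfl⟩ (IsPreconnected.union (Q.left Q.c)
        ⟨Q.c, Q.c_mem_stage n, rfl⟩ (left_mem_segment ℝ _ _)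
        (h.image _ Q.continuous_left.continuousOn) (convex_segment _ _).isPreconnected)
      (h.image _ Q.continuous_right.continuousOn)

/-- The fractal: the compact connected set `K` with `K = left K ∪ bridge ∪ right K`. -/
def fractal : Set E := ⋂ n, Q.stage n

theorem isCompact_fractal : IsCompact Q.fractal :=
  Q.isCompact_B.of_isClosed_subset (isClosed_iInter fun n => (Q.isCompact_stage n).isClosed)
    (iInter_subset _ 0)

theorem fractal_subset : Q.fractal ⊆ Q.B := iInter_subset _ 0

theorem isConnected_fractal : IsConnected Q.fractal :=
  ⟨⟨0, mem_iInter.2 Q.zero_mem_stage⟩,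
    isPreconnected_iInter_of_antitone Q.antitone_stage Q.isCompact_stage Q.isPreconnected_stage⟩

/-- The value of `ℓ` decides which piece of every stage contains `x`. As the two similarities are
injective, the preimage is the same point for all stages, hence lies in their intersection. -/
theorem fractal_cases {x : E} (hx : x ∈ Q.fractal) :
    (Q.ℓ x ≤ Q.lam ∧ ∃ y ∈ Q.fractal, x = Q.left y) ∨
    (1 - Q.lam ≤ Q.ℓ x ∧ ∃ y ∈ Q.fractal, x = Q.right y) ∨
    (Q.lam < Q.ℓ x ∧ Q.ℓ x < 1 - Q.lam ∧ x ∈ Q.bridge) := by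
  have hlam := Q.lam_lt
  have hx' : ∀ n, x ∈ Q.stage (n + 1) := fun n => mem_iInter.1 hx (n + 1)
  by_cases h1 : Q.ℓ x ≤ Q.lam
  · have key : ∀ n, ∃ y ∈ Q.stage n, x = Q.left y := fun n => by
      rcases hx' n with (⟨y, hy, rfl⟩ | hb) | ⟨y, hy, rfl⟩
      · exact ⟨y, hy, rfl⟩
      · obtain ⟨t, h0, -, h3, h4⟩ := Q.exists_of_mem_bridge hb
        -- The only bridge point with `ℓ x ≤ lam` is its left endpoint, the image of the corner `c`,
        -- so it also belongs to the left part.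
        have : t = 0 := by nlinarith
        rw [this, zero_smul, sub_eq_zero] at h3
        exact ⟨Q.c, Q.c_mem_stage n, h3⟩
      · have := Q.nonneg_ℓ y (Q.stage_subset n hy)
        rw [ℓ_right] at h1
        linarith
    refine Or.inl ⟨h1, Q.leftInv x, mem_iInter.2 fun n => ?_, ?_⟩
    · obtain ⟨y, hy, rfl⟩ := key n
      rwa [Q.leftInv_left]
    · obtain ⟨y, hy, rfl⟩ := key 0
      rw [Q.leftInv_left]
  by_cases h2 : 1 - Q.lam ≤ Q.ℓ x
  · have key : ∀ n, ∃ y ∈ Q.stage n, x = Q.right y := fun n => by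
      rcases hx' n with (⟨y, hy, rfl⟩ | hb) | ⟨y, hy, rfl⟩
      · have := Q.ℓ_le_lam y (Q.stage_subset n hy)
        rw [ℓ_left] at h2
        linarith
      · obtain ⟨t, h0, h0', h3, h4⟩ := Q.exists_of_mem_bridge hb
        have : t = 1 := by nlinarith
        rw [this, one_smul, sub_left_inj] at h3
        exact ⟨0, Q.zero_mem_stage n, h3⟩
      · exact ⟨y, hy, rfl⟩
    refine Or.inr (Or.inl ⟨h2, Q.rightInv x, mem_iInter.2 fun n => ?_, ?_⟩)
    · obtain ⟨y, hy, rfl⟩ := key n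
      rwa [Q.rightInv_right]
    · obtain ⟨y, hy, rfl⟩ := key 0
      rw [Q.rightInv_right]
  · push Not at h1 h2
    refine Or.inr (Or.inr ⟨h1, h2, ?_⟩)
    rcases hx' 0 with (⟨y, hy, rfl⟩ | hb) | ⟨y, hy, rfl⟩
    · have := Q.ℓ_le_lam y (Q.stage_subset 0 hy)
      rw [ℓ_left] at h1
      linarith
    · exact hb
    · have := Q.nonneg_ℓ y (Q.stage_subset 0 hy)
      rw [ℓ_right] at h2
      linarith

theorem exists_height : ∃ v : E → ℝ, (∀ x, 0 ≤ v x) ∧ (∀ x, v x ≤ 1) ∧ v 0 = 0 ∧ v Q.c = 1 ∧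
    (∀ x, Q.ℓ (Q.left x) ≤ Q.lam → v (Q.left x) = v x / 2) ∧
    (∀ x, 1 - Q.lam ≤ Q.ℓ (Q.right x) → v (Q.right x) = (1 + v x) / 2) ∧
    ∀ x, Q.lam < Q.ℓ x → Q.ℓ x < 1 - Q.lam → v x = 1 / 2 := by
  have hlam := Q.lam_lt
  -- The digit is 0 on the left and 1 elsewhere. Slab points are sent to the origin, whose height is
  -- 0, so their height is 1/2.
  obtain ⟨v, h0, h1, h⟩ := exists_binary_coding
    (fun x => if Q.ℓ x ≤ Q.lam then (0 : ℝ) else 1) (fun x => by split_ifs <;> norm_num)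
    (fun x => by split_ifs <;> norm_num)
    (fun x => if Q.ℓ x ≤ Q.lam then Q.leftInv x else if 1 - Q.lam ≤ Q.ℓ x then Q.rightInv x else 0)
  have hl : ∀ x, Q.ℓ (Q.left x) ≤ Q.lam → v (Q.left x) = v x / 2 := fun x hx => by
    rw [h, if_pos hx, if_pos hx, Q.leftInv_left, zero_add]
  have hr : ∀ x, 1 - Q.lam ≤ Q.ℓ (Q.right x) → v (Q.right x) = (1 + v x) / 2 := fun x hx => by
    have hx' : ¬ Q.ℓ (Q.right x) ≤ Q.lam := by linarith
    rw [h, if_neg hx', if_neg hx', if_pos hx, Q.rightInv_right]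
  have hv0 : v 0 = 0 := by
    have := hl 0 (by simp [Q.left_zero, Q.lam_pos.le])
    rw [Q.left_zero] at this
    linarith
  have hvc : v Q.c = 1 := by
    have := hr Q.c (by rw [ℓ_right, Q.ℓ_c]; linarith [Q.lam_pos])
    rw [Q.right_c] at this
    linarith
  refine ⟨v, h0, h1, hv0, hvc, hl, hr, fun x hx hx' => ?_⟩
  rw [h, if_neg hx.not_ge, if_neg hx.not_ge, if_neg hx'.not_ge, hv0]
  norm_num

theorem le_of_forall_le_add_half_pow {a b : ℝ} (h : ∀ n : ℕ, a ≤ b + (1 / 2) ^ n) : a ≤ b := by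
  have ht : Tendsto (fun n : ℕ => b + (1 / 2 : ℝ) ^ n) atTop (𝓝 (b + 0)) :=
    tendsto_const_nhds.add (tendsto_pow_atTop_nhds_zero_of_lt_one (by norm_num) (by norm_num))
  rw [add_zero] at ht
  exact ge_of_tendsto' ht h

/-- Both `|v x - v y|` and `‖x - y‖ ^ β` are halved by each similarity, so pairs in the same part
are reduced to the previous scale. An error `(1 / 2) ^ n` starts the induction, where `0 ≤ v ≤ 1`
suffices, and vanishes in the limit. -/
theorem exists_holder_height {β : ℝ} (hβ : 0 < β) (hμ : Q.μ ^ β = 1 / 2) :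
    ∃ v : E → ℝ, v 0 = 0 ∧ v Q.c = 1 ∧
      ∃ C : ℝ, ∀ x ∈ Q.fractal, ∀ y ∈ Q.fractal, |v x - v y| ≤ C * ‖x - y‖ ^ β := by
  obtain ⟨v, h0, h1, hv0, hvc, hl, hr, hm⟩ := Q.exists_height
  have hlam := Q.lam_lt
  have hlam0 := Q.lam_pos
  have hscale : ∀ a : ℝ, 0 ≤ a → (Q.μ * a) ^ β = a ^ β / 2 := fun a ha => by
    rw [Real.mul_rpow Q.μ_pos.le ha, hμ]
    ring
  have hleft : ∀ x y, ‖Q.left x - Q.left y‖ ^ β = ‖x - y‖ ^ β / 2 := fun x y => by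
    rw [norm_left_sub, hscale _ (norm_nonneg _)]
  have hright : ∀ x y, ‖Q.right x - Q.right y‖ ^ β = ‖x - y‖ ^ β / 2 := fun x y => by
    rw [norm_right_sub, hscale _ (norm_nonneg _)]
  have hℓ : ∀ x y, Q.ℓ x - Q.ℓ y ≤ ‖x - y‖ := fun x y => by
    rw [← map_sub]
    exact (le_abs_self _).trans (Q.ℓ_le _)
  -- Points outside the part that contains a corner are at distance at least `lam` from it, and
  -- there the bound is trivial with this constant.
  obtain ⟨C₁, hC₁0, hC₁⟩ : ∃ C₁ : ℝ, 0 ≤ C₁ ∧ ∀ a : ℝ, Q.lam ≤ a → 1 ≤ C₁ * a ^ β := by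
    refine ⟨(Q.lam ^ β)⁻¹, by positivity, fun a ha => ?_⟩
    rw [inv_mul_eq_div, one_le_div (by positivity)]
    exact Real.rpow_le_rpow hlam0.le ha hβ.le
  have corner : ∀ n : ℕ, ∀ x ∈ Q.fractal, 1 - v x ≤ C₁ * ‖Q.c - x‖ ^ β + (1 / 2) ^ n := by
    intro n
    induction n with
    | zero =>
      intro x _
      have : 0 ≤ C₁ * ‖Q.c - x‖ ^ β := by positivity
      have := h0 x
      simp
      linarith
    | succ n ih =>
      intro x hx
      have hfar : Q.ℓ x < 1 - Q.lam → 1 - v x ≤ C₁ * ‖Q.c - x‖ ^ β + (1 / 2) ^ (n + 1) := by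
        intro h
        have h2 := hC₁ ‖Q.c - x‖ (by
          have h3 := hℓ Q.c x
          rw [← Q.right_c, ℓ_right, Q.ℓ_c, Q.right_c] at h3
          linarith)
        have h3 : (0 : ℝ) ≤ (1 / 2) ^ (n + 1) := by positivity
        linarith [h0 x]
      rcases Q.fractal_cases hx with ⟨h, -⟩ | ⟨h, y, hy, rfl⟩ | ⟨-, h, -⟩
      · exact hfar (by linarith)
      · have := ih y hy
        rw [hr y h]
        conv_rhs => rw [← Q.right_c, hright, pow_succ]
        linarith
      · exact hfar h
  have corner' : ∀ n : ℕ, ∀ x ∈ Q.fractal, v x ≤ C₁ * ‖x - 0‖ ^ β + (1 / 2) ^ n := by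
    intro n
    induction n with
    | zero =>
      intro x _
      have : 0 ≤ C₁ * ‖x - 0‖ ^ β := by positivity
      have := h1 x
      simp only [pow_zero]
      linarith
    | succ n ih =>
      intro x hx
      have hfar : Q.lam < Q.ℓ x → v x ≤ C₁ * ‖x - 0‖ ^ β + (1 / 2) ^ (n + 1) := by
        intro h
        have h2 := hC₁ ‖x - 0‖ (by
          have h3 := hℓ x 0
          rw [map_zero, sub_zero] at h3
          linarith)
        have h3 : (0 : ℝ) ≤ (1 / 2) ^ (n + 1) := by positivity
        linarith [h1 x]
      rcases Q.fractal_cases hx with ⟨h, y, hy, rfl⟩ | ⟨h, -⟩ | ⟨h, -, -⟩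
      · have := ih y hy
        rw [hl y h]
        conv_rhs => rw [← Q.left_zero, hleft, pow_succ]
        linarith
      · exact hfar (by linarith)
      · exact hfar h
  have hc : ∀ x ∈ Q.fractal, 1 - v x ≤ C₁ * ‖Q.c - x‖ ^ β := fun x hx =>
    le_of_forall_le_add_half_pow fun n => corner n x hx
  have hz : ∀ x ∈ Q.fractal, v x ≤ C₁ * ‖x - 0‖ ^ β := fun x hx =>
    le_of_forall_le_add_half_pow fun n => corner' n x hx
  set w := 1 - 2 * Q.lam with hw
  have hw0 : 0 < w := by rw [hw]; linarith
  -- `w` is the width of the slab. Along the bridge the distance to an endpoint is at most `L - 1`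
  -- times the change of `ℓ`. So replacing a bridge point by the endpoint at the part containing `y`
  -- costs at most the factor `L`.
  set L := 1 + ‖Q.right 0 - Q.left Q.c‖ / w with hL
  have hL0 : 0 ≤ L := by positivity
  have nearLeft : ∀ x ∈ Q.bridge, ∀ y, Q.ℓ y ≤ Q.lam → ‖Q.left Q.c - y‖ ≤ L * ‖x - y‖ := by
    intro x hx y hy
    obtain ⟨t, ht0, ht1, ht, hℓx⟩ := Q.exists_of_mem_bridge hx
    have h2 : t * w ≤ ‖x - y‖ := by linarith [hℓ x y]
    have h3 : ‖x - Q.left Q.c‖ = t * w * (‖Q.right 0 - Q.left Q.c‖ / w) := by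
      rw [ht, norm_smul, Real.norm_of_nonneg ht0]
      field_simp
    have h4 : ‖Q.left Q.c - y‖ ≤ ‖x - Q.left Q.c‖ + ‖x - y‖ := by
      rw [norm_sub_rev x (Q.left Q.c)]
      exact norm_sub_le_norm_sub_add_norm_sub _ _ _
    have h5 : 0 ≤ ‖Q.right 0 - Q.left Q.c‖ / w := by positivity
    rw [h3] at h4
    rw [hL, add_mul, one_mul, mul_comm (_ / w)]
    linarith [mul_le_mul_of_nonneg_right h2 h5]
  have nearRight : ∀ x ∈ Q.bridge, ∀ y, 1 - Q.lam ≤ Q.ℓ y →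
      ‖y - Q.right 0‖ ≤ L * ‖y - x‖ := by
    intro x hx y hy
    obtain ⟨t, ht0, ht1, ht, hℓx⟩ := Q.exists_of_mem_bridge hx
    have h2 : (1 - t) * w ≤ ‖y - x‖ := by linarith [hℓ y x]
    have h3 : ‖x - Q.right 0‖ = (1 - t) * w * (‖Q.right 0 - Q.left Q.c‖ / w) := by
      have : x - Q.right 0 = -((1 - t) • (Q.right 0 - Q.left Q.c)) := by
        rw [sub_smul, one_smul, ← ht]
        abel
      rw [this, norm_neg, norm_smul, Real.norm_of_nonneg (by linarith)]
      field_simp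
    have h4 : ‖y - Q.right 0‖ ≤ ‖y - x‖ + ‖x - Q.right 0‖ :=
      norm_sub_le_norm_sub_add_norm_sub _ _ _
    have h5 : 0 ≤ ‖Q.right 0 - Q.left Q.c‖ / w := by positivity
    rw [h3] at h4
    rw [hL, add_mul, one_mul, mul_comm (_ / w)]
    linarith [mul_le_mul_of_nonneg_right h2 h5]
  -- The first summand handles points in opposite parts, the second a point of a part and a point of
  -- the bridge, through the corner estimates `hc` and `hz`.
  set C := (w ^ β)⁻¹ + C₁ * L ^ β with hC
  have hCw : 0 ≤ (w ^ β)⁻¹ := by positivity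
  have hCL : 0 ≤ C₁ * L ^ β := by positivity
  have hC0 : 0 ≤ C := by positivity
  have lr : ∀ x y, Q.ℓ x ≤ Q.lam → 1 - Q.lam ≤ Q.ℓ y → 1 ≤ C * ‖y - x‖ ^ β := by
    intro x y hx hy
    have h2 : w ≤ ‖y - x‖ := by linarith [hℓ y x]
    have h3 : 1 ≤ (w ^ β)⁻¹ * ‖y - x‖ ^ β := by
      rw [inv_mul_eq_div, one_le_div (by positivity)]
      exact Real.rpow_le_rpow hw0.le h2 hβ.le
    have : 0 ≤ C₁ * L ^ β * ‖y - x‖ ^ β := by positivity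
    rw [hC, add_mul]
    linarith
  have lb : ∀ x ∈ Q.fractal, ∀ y ∈ Q.bridge, Q.ℓ (Q.left x) ≤ Q.lam →
      |v (Q.left x) - 1 / 2| ≤ C * ‖y - Q.left x‖ ^ β := by
    intro x hx y hy h
    have h2 := hc x hx
    have h3 : ‖Q.left Q.c - Q.left x‖ ^ β ≤ (L * ‖y - Q.left x‖) ^ β :=
      Real.rpow_le_rpow (norm_nonneg _) (nearLeft y hy _ h) hβ.le
    rw [hleft, Real.mul_rpow hL0 (norm_nonneg _)] at h3
    have h4 : 0 ≤ (w ^ β)⁻¹ * ‖y - Q.left x‖ ^ β := by positivity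
    have h5 := mul_le_mul_of_nonneg_left h3 hC₁0
    rw [hl x h, abs_of_nonpos (by linarith [h1 x]), hC, add_mul]
    linarith
  have br : ∀ x ∈ Q.fractal, ∀ y ∈ Q.bridge, 1 - Q.lam ≤ Q.ℓ (Q.right x) →
      |v (Q.right x) - 1 / 2| ≤ C * ‖Q.right x - y‖ ^ β := by
    intro x hx y hy h
    have h2 := hz x hx
    have h3 : ‖Q.right x - Q.right 0‖ ^ β ≤ (L * ‖Q.right x - y‖) ^ β :=
      Real.rpow_le_rpow (norm_nonneg _) (nearRight y hy _ h) hβ.le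
    rw [hright, Real.mul_rpow hL0 (norm_nonneg _)] at h3
    have h4 : 0 ≤ (w ^ β)⁻¹ * ‖Q.right x - y‖ ^ β := by positivity
    have h5 := mul_le_mul_of_nonneg_left h3 hC₁0
    rw [hr x h, abs_of_nonneg (by linarith [h0 x]), hC, add_mul]
    linarith
  have main : ∀ n : ℕ, ∀ x ∈ Q.fractal, ∀ y ∈ Q.fractal,
      |v x - v y| ≤ C * ‖x - y‖ ^ β + (1 / 2) ^ n := by
    intro n
    induction n with
    | zero =>
      intro x _ y _
      have : 0 ≤ C * ‖x - y‖ ^ β := by positivity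
      have : |v x - v y| ≤ 1 := abs_le.2 ⟨by linarith [h0 x, h1 y], by linarith [h0 y, h1 x]⟩
      simp only [pow_zero]
      linarith
    | succ n ih =>
      intro x hx y hy
      have hp : (0 : ℝ) ≤ (1 / 2) ^ (n + 1) := by positivity
      have hbd : ∀ x y, |v x - v y| ≤ 1 := fun x y =>
        abs_le.2 ⟨by linarith [h0 x, h1 y], by linarith [h0 y, h1 x]⟩
      rcases Q.fractal_cases hx with ⟨hx1, x', hx', rfl⟩ | ⟨hx1, x', hx', rfl⟩ | ⟨hx1, hx2, hxb⟩ <;>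
      rcases Q.fractal_cases hy with ⟨hy1, y', hy', rfl⟩ | ⟨hy1, y', hy', rfl⟩ | ⟨hy1, hy2, hyb⟩
      · have := ih x' hx' y' hy'
        rw [hl x' hx1, hl y' hy1, hleft, ← sub_div, abs_div, abs_two, pow_succ]
        linarith
      · have := lr _ _ hx1 hy1
        rw [norm_sub_rev] at this
        linarith [hbd (Q.left x') (Q.right y')]
      · have := lb x' hx' y hyb hx1
        rw [hm y hy1 hy2, norm_sub_rev]
        linarith
      · have := lr _ _ hy1 hx1
        linarith [hbd (Q.right x') (Q.left y')]
      · have := ih x' hx' y' hy'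
        rw [hr x' hx1, hr y' hy1, hright, ← sub_div, abs_div, abs_two, pow_succ,
          add_sub_add_left_eq_sub]
        linarith
      · have := br x' hx' y hyb hx1
        rw [hm y hy1 hy2]
        linarith
      · have := lb y' hy' x hxb hy1
        rw [hm x hx1 hx2, abs_sub_comm]
        linarith
      · have := br y' hy' x hxb hy1
        rw [hm x hx1 hx2, abs_sub_comm, norm_sub_rev]
        linarith
      · rw [hm x hx1 hx2, hm y hy1 hy2, sub_self, abs_zero]
        positivity
  exact ⟨v, hv0, hvc, C, fun x hx y hy => le_of_forall_le_add_half_pow fun n => main n x hx y hy⟩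

end BoxSplitting

theorem finRotate_symm_zero (m : ℕ) : (finRotate (m + 1)).symm 0 = Fin.last m := by
  rw [Equiv.symm_apply_eq, finRotate_last]

theorem finRotate_symm_succ {m : ℕ} (i : Fin m) :
    (finRotate (m + 1)).symm i.succ = i.castSucc := by
  rw [Equiv.symm_apply_eq, finRotate_apply, Fin.coeSucc_eq_succ]

/-- The splitting of the box `∏ [0, μ^j]` in the direction of its longest side. -/
def boxSplitting (m : ℕ) (μ : ℝ) (h0 : 0 < μ) (h1 : μ ^ (m + 1) < 1 / 2) :
    BoxSplitting (EuclideanSpace ℝ (Fin (m + 1))) where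
  -- The rotation moves the shortest side `μ ^ m` to the first place. After contraction it has
  -- length `μ ^ (m + 1)`, while the side `μ ^ i` becomes the side of index `i + 1`, so the other
  -- sides of the box are filled exactly.
  R := LinearIsometryEquiv.piLpCongrLeft 2 ℝ ℝ (finRotate (m + 1))
  ℓ := EuclideanSpace.proj 0
  e := EuclideanSpace.single 0 1
  c := WithLp.toLp 2 fun j => μ ^ (j : ℕ)
  μ := μ
  lam := μ ^ (m + 1)
  B := {x | ∀ j, 0 ≤ x j ∧ x j ≤ μ ^ (j : ℕ)}
  μ_pos := h0
  lam_pos := by positivity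
  lam_lt := h1
  ℓ_le x := PiLp.norm_apply_le x 0
  ℓ_e := by simp
  isCompact_B := by
    have h : IsCompact (Set.pi univ fun j : Fin (m + 1) => Icc (0 : ℝ) (μ ^ (j : ℕ))) :=
      isCompact_univ_pi fun j => isCompact_Icc
    have h' := h.image (PiLp.continuous_toLp 2 fun _ : Fin (m + 1) => ℝ)
    refine (congrArg IsCompact ?_).mpr h'
    ext x
    constructor
    · intro hx
      exact ⟨x.ofLp, fun j _ => hx j, rfl⟩
    · rintro ⟨y, hy, rfl⟩ j
      exact hy j (mem_univ j)
  convex_B := by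
    intro x hx y hy a b ha hb hab j
    have h1 := hx j
    have h2 := hy j
    simp only [PiLp.add_apply, PiLp.smul_apply, smul_eq_mul]
    refine ⟨add_nonneg (mul_nonneg ha h1.1) (mul_nonneg hb h2.1), ?_⟩
    calc a * x j + b * y j ≤ a * μ ^ (j : ℕ) + b * μ ^ (j : ℕ) :=
          add_le_add (mul_le_mul_of_nonneg_left h1.2 ha) (mul_le_mul_of_nonneg_left h2.2 hb)
      _ = μ ^ (j : ℕ) := by rw [← add_mul, hab, one_mul]
  zero_mem := fun j => ⟨le_rfl, by simp; positivity⟩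
  c_mem := fun j => ⟨by simp; positivity, le_rfl⟩
  left_mem := by
    intro x hx j
    simp only [PiLp.smul_apply, LinearIsometryEquiv.piLpCongrLeft_apply, smul_eq_mul]
    induction j using Fin.cases with
    | zero =>
      have h := hx (Fin.last m)
      simp only [Equiv.piCongrLeft'_apply, finRotate_symm_zero]
      refine ⟨mul_nonneg h0.le h.1, (mul_le_mul_of_nonneg_left h.2 h0.le).trans ?_⟩
      simp only [Fin.val_last, ← pow_succ', Fin.val_zero, pow_zero]
      linarith
    | succ i =>
      have h := hx i.castSucc
      simp only [Equiv.piCongrLeft'_apply, finRotate_symm_succ]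
      refine ⟨mul_nonneg h0.le h.1, (mul_le_mul_of_nonneg_left h.2 h0.le).trans ?_⟩
      simp [← pow_succ']
  right_mem := by
    intro x hx j
    simp only [PiLp.add_apply, PiLp.smul_apply, LinearIsometryEquiv.piLpCongrLeft_apply,
      smul_eq_mul]
    induction j using Fin.cases with
    | zero =>
      have h := hx (Fin.last m)
      have h2 := mul_le_mul_of_nonneg_left h.2 h0.le
      simp only [Fin.val_last, ← pow_succ'] at h2
      have h3 := mul_nonneg h0.le h.1
      simp only [Equiv.piCongrLeft'_apply, finRotate_symm_zero]
      simp only [PiLp.single_apply, if_true, mul_one, Fin.val_zero, pow_zero]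
      constructor <;> linarith
    | succ i =>
      have h := hx i.castSucc
      simp only [Equiv.piCongrLeft'_apply, finRotate_symm_succ]
      simp only [PiLp.single_apply, Fin.succ_ne_zero, if_false, mul_zero, zero_add]
      refine ⟨mul_nonneg h0.le h.1, (mul_le_mul_of_nonneg_left h.2 h0.le).trans ?_⟩
      simp [← pow_succ']
  nonneg_ℓ := by
    intro x hx
    exact mul_nonneg h0.le (hx _).1
  ℓ_le_lam := by
    intro x hx
    have h := hx (Fin.last m)
    simp only [PiLp.proj_apply, LinearIsometryEquiv.piLpCongrLeft_apply,
      Equiv.piCongrLeft'_apply, finRotate_symm_zero]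
    exact (mul_le_mul_of_nonneg_left h.2 h0.le).trans (by simp [← pow_succ'])
  c_fixed := by
    ext j
    simp only [PiLp.add_apply, PiLp.smul_apply, LinearIsometryEquiv.piLpCongrLeft_apply,
      smul_eq_mul]
    induction j using Fin.cases with
    | zero =>
      simp only [Equiv.piCongrLeft'_apply, finRotate_symm_zero]
      simp [← pow_succ']
    | succ i =>
      simp only [Equiv.piCongrLeft'_apply, finRotate_symm_succ]
      simp [← pow_succ']
  ℓ_c := by
    simp only [PiLp.proj_apply, LinearIsometryEquiv.piLpCongrLeft_apply,
      Equiv.piCongrLeft'_apply, finRotate_symm_zero]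
    simp [← pow_succ']

/-- For every `β < d` there are a compact connected set `K ⊆ [0, 1]^d` and a function that is
Hölder continuous of exponent `β` and not constant on `K`. -/
theorem exists_fractal_height {d : ℕ} {β : ℝ} (hβ : 0 < β) (hβd : β < d) :
    ∃ (K : Set (EuclideanSpace ℝ (Fin d))) (v : EuclideanSpace ℝ (Fin d) → ℝ),
      IsCompact K ∧ IsConnected K ∧ (∀ x ∈ K, ∀ j, 0 ≤ x j ∧ x j ≤ 1) ∧
      (∃ x ∈ K, ∃ y ∈ K, v x ≠ v y) ∧
      ∃ C : ℝ, ∀ x ∈ K, ∀ y ∈ K, |v x - v y| ≤ C * ‖x - y‖ ^ β := by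
  obtain _ | m := d
  · simp at hβd
    linarith
  -- With this ratio `μ ^ β = 1 / 2`; then `β < d` and `μ < 1` give `μ ^ d < 1 / 2`, the room for
  -- two copies.
  set μ : ℝ := (1 / 2) ^ (1 / β) with hμ
  have h0 : 0 < μ := by positivity
  have hμβ : μ ^ β = 1 / 2 := by
    rw [hμ, ← Real.rpow_mul (by norm_num), one_div_mul_cancel hβ.ne', Real.rpow_one]
  have h1 : μ ^ (m + 1) < 1 / 2 := by
    rw [← hμβ, ← Real.rpow_natCast]
    refine Real.rpow_lt_rpow_of_exponent_gt h0 ?_ hβd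
    exact Real.rpow_lt_one (by norm_num) (by norm_num) (by positivity)
  have hμ1 : μ ≤ 1 := Real.rpow_le_one (by norm_num) (by norm_num) (by positivity)
  let Q := boxSplitting m μ h0 h1
  obtain ⟨v, hv0, hvc, hC⟩ := Q.exists_holder_height hβ hμβ
  refine ⟨Q.fractal, v, Q.isCompact_fractal, Q.isConnected_fractal, fun x hx j => ?_,
    ⟨0, mem_iInter.2 Q.zero_mem_stage, Q.c, mem_iInter.2 Q.c_mem_stage, ?_⟩, hC⟩
  · have h := Q.fractal_subset hx j
    exact ⟨h.1, h.2.trans (pow_le_one₀ h0.le hμ1)⟩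
  · rw [hv0, hvc]
    exact zero_ne_one

end Fractal

/-! ### Dyadic partitions of unity near a compact set -/

section FlatExtension

/-- A smooth function on `ℝ` with support in `[-1, 1]` whose integer translates sum to `1`. -/
def tent (t : ℝ) : ℝ := Real.smoothTransition (t + 1) - Real.smoothTransition t

theorem contDiff_tent : ContDiff ℝ ∞ tent :=
  (Real.smoothTransition.contDiff.comp (contDiff_id.add contDiff_const)).sub
    Real.smoothTransition.contDiff

theorem abs_le_one_of_tent_ne_zero {t : ℝ} (h : tent t ≠ 0) : |t| ≤ 1 := by
  by_contra! h1
  apply h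
  rcases lt_abs.1 h1 with h2 | h2
  · rw [tent, Real.smoothTransition.one_of_one_le (by linarith),
      Real.smoothTransition.one_of_one_le h2.le, sub_self]
  · rw [tent, Real.smoothTransition.zero_of_nonpos (by linarith),
      Real.smoothTransition.zero_of_nonpos (by linarith), sub_self]

/-- The sum telescopes to `smoothTransition (t - a + 1) - smoothTransition (t - b)`, which is `1 -
0`. -/
theorem sum_tent_eq_one {t : ℝ} {a b : ℤ} (ha : a ≤ t) (hb : t ≤ b) :
    ∑ k ∈ Finset.Icc a b, tent (t - k) = 1 := by
  have key : ∀ n : ℕ, ∑ k ∈ Finset.Icc a (a + n), tent (t - k) =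
      Real.smoothTransition (t - a + 1) - Real.smoothTransition (t - (a + n)) := by
    intro n
    induction n with
    | zero => simp [tent]
    | succ n ih =>
      have h1 : Finset.Icc a (a + ((n + 1 : ℕ) : ℤ)) =
          insert (a + ((n + 1 : ℕ) : ℤ)) (Finset.Icc a (a + n)) := by
        ext k
        simp only [Finset.mem_Icc, Finset.mem_insert]
        push_cast
        omega
      rw [h1, Finset.sum_insert (by simp), ih, tent]
      push_cast
      rw [show t - (a + (n + 1 : ℝ)) + 1 = t - (a + n) by ring]
      ring
  have hab : a ≤ b := by exact_mod_cast ha.trans hb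
  have hn : a + ((b - a).toNat : ℤ) = b := by omega
  have h := key (b - a).toNat
  rw [hn] at h
  have h2 : ((a : ℝ) + ((b - a).toNat : ℕ)) = b := by exact_mod_cast hn
  rw [h, h2, Real.smoothTransition.one_of_one_le (by linarith),
    Real.smoothTransition.zero_of_nonpos (by linarith), sub_zero]

variable {d : ℕ}

/-- The bump of size `2^{-n}` at the lattice point `2^{-n} z`. -/
def cell (n : ℕ) (z : Fin d → ℤ) (x : EuclideanSpace ℝ (Fin d)) : ℝ :=
  ∏ j, tent (2 ^ n * x j - z j)

theorem contDiff_cell (n : ℕ) (z : Fin d → ℤ) : ContDiff ℝ ∞ (cell n z) := by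
  unfold cell
  refine contDiff_prod fun j _ => contDiff_tent.comp ?_
  refine (contDiff_const.mul ?_).sub contDiff_const
  exact (EuclideanSpace.proj (𝕜 := ℝ) j).contDiff

theorem tsupport_cell_subset (n : ℕ) (z : Fin d → ℤ) :
    tsupport (cell n z) ⊆ {x | ∀ j, |2 ^ n * x j - z j| ≤ 1} := by
  refine closure_minimal (fun x hx j => ?_) ?_
  · have h : cell n z x ≠ 0 := hx
    rw [cell, Finset.prod_ne_zero_iff] at h
    exact abs_le_one_of_tent_ne_zero (h j (Finset.mem_univ j))
  · simp only [ofPred_forall]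
    refine isClosed_iInter fun j => isClosed_le ?_ continuous_const
    exact ((continuous_const.mul (EuclideanSpace.proj (𝕜 := ℝ) j).continuous).sub
      continuous_const).abs

theorem norm_le_of_forall_abs_le {x : EuclideanSpace ℝ (Fin d)} {r : ℝ} (hr : 0 ≤ r)
    (h : ∀ j, |x j| ≤ r) : ‖x‖ ≤ d * r := by
  rw [EuclideanSpace.norm_eq, Real.sqrt_le_iff]
  refine ⟨by positivity, ?_⟩
  calc ∑ j, ‖x j‖ ^ 2 ≤ ∑ _j : Fin d, r ^ 2 :=
        Finset.sum_le_sum fun j _ => pow_le_pow_left₀ (norm_nonneg _) (h j) 2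
    _ = d * r ^ 2 := by simp
    _ ≤ (d * r) ^ 2 := by
        rw [mul_pow]
        gcongr
        exact_mod_cast Nat.le_self_pow two_ne_zero d

/-- All bumps are copies of the one compactly supported bump `cell 0 0` under dilation by `2 ^ n`
and translation. -/
theorem exists_bound_iteratedFDeriv_cell (d N : ℕ) : ∃ A : ℝ, 0 ≤ A ∧
    ∀ (n : ℕ) (z : Fin d → ℤ), ∀ i ≤ N, ∀ x, ‖iteratedFDeriv ℝ i (cell n z) x‖ ≤ A * (2 ^ n) ^ i := by
  have hcs : HasCompactSupport (cell (d := d) 0 0) := by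
    refine (isCompact_closedBall (0 : EuclideanSpace ℝ (Fin d)) (d * 1)).of_isClosed_subset
      (isClosed_tsupport _) fun x hx => ?_
    rw [mem_closedBall_zero_iff]
    refine norm_le_of_forall_abs_le zero_le_one fun j => ?_
    simpa using tsupport_cell_subset 0 0 hx j
  have hb : ∀ i : ℕ, ∃ C, ∀ y, ‖iteratedFDeriv ℝ i (cell (d := d) 0 0) y‖ ≤ C := fun i =>
    ((contDiff_cell 0 0).continuous_iteratedFDeriv
      (by exact_mod_cast le_top)).bounded_above_of_compact_support (hcs.iteratedFDeriv i)
  choose C hC using hb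
  have hC0 : ∀ i, 0 ≤ C i := fun i => (norm_nonneg _).trans (hC i 0)
  refine ⟨N.factorial * ∑ i ∈ Finset.range (N + 1), C i,
    mul_nonneg (by positivity) (Finset.sum_nonneg fun i _ => hC0 i), fun n z i hi x => ?_⟩
  let h : EuclideanSpace ℝ (Fin d) → EuclideanSpace ℝ (Fin d) := fun x =>
    (2 ^ n : ℝ) • x - WithLp.toLp 2 fun j => (z j : ℝ)
  have hcomp : cell n z = cell 0 0 ∘ h := by
    ext x
    simp [cell, h]
  have hh : ContDiff ℝ ∞ h := (contDiff_const_smul _).sub contDiff_const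
  have hfd : fderiv ℝ h = fun _ => (2 ^ n : ℝ) • ContinuousLinearMap.id ℝ _ := by
    ext1 x
    exact (((hasFDerivAt_id x).const_smul (2 ^ n : ℝ)).sub_const _).fderiv
  rw [hcomp]
  refine (norm_iteratedFDeriv_comp_le (contDiff_cell 0 0) hh (by exact_mod_cast le_top) x
    (C := ∑ i ∈ Finset.range (N + 1), C i) (D := 2 ^ n) (fun j hj => ?_) (fun j hj1 hj => ?_)).trans ?_
  · exact (hC j _).trans (Finset.single_le_sum (fun j _ => hC0 j) (Finset.mem_range.2 (by omega)))
  · obtain ⟨j, rfl⟩ : ∃ k, j = k + 1 := ⟨j - 1, by omega⟩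
    rw [← norm_iteratedFDeriv_fderiv, hfd]
    rcases Nat.eq_zero_or_pos j with rfl | hj0
    · rw [norm_iteratedFDeriv_zero, norm_smul, zero_add, pow_one]
      refine (mul_le_of_le_one_right (norm_nonneg _) ContinuousLinearMap.norm_id_le).trans ?_
      simp
    · rw [iteratedFDeriv_const_of_ne hj0.ne']
      simp
  · have h0 : 0 ≤ ∑ i ∈ Finset.range (N + 1), C i := Finset.sum_nonneg fun i _ => hC0 i
    have h2 : (i.factorial : ℝ) ≤ N.factorial := by exact_mod_cast Nat.factorial_le hi
    gcongr

/-- At most `3^d` bumps of a given size are active at a given point. -/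
theorem norm_sum_le_of_active {G : Type*} [SeminormedAddCommGroup G] (Z : Finset (Fin d → ℤ))
    (g : (Fin d → ℤ) → G) (n : ℕ) (x : EuclideanSpace ℝ (Fin d)) {b : ℝ} (hb : 0 ≤ b)
    (h0 : ∀ z ∈ Z, x ∉ tsupport (cell n z) → g z = 0)
    (h1 : ∀ z ∈ Z, x ∈ tsupport (cell n z) → ‖g z‖ ≤ b) : ‖∑ z ∈ Z, g z‖ ≤ 3 ^ d * b := by
  classical
  -- Each coordinate of an active lattice point is an integer within 1 of `2 ^ n * x j`, and there
  -- are at most three of these.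
  let A : Finset (Fin d → ℤ) := Fintype.piFinset fun j =>
    Finset.Icc ⌈(2 ^ n * x j - 1 : ℝ)⌉ ⌊(2 ^ n * x j + 1 : ℝ)⌋
  have hA : A.card ≤ 3 ^ d := by
    rw [Fintype.card_piFinset]
    refine (Finset.prod_le_pow_card _ _ 3 fun j _ => ?_).trans (by simp)
    rw [Int.card_Icc]
    have h2 := Int.floor_le (2 ^ n * x j + 1 : ℝ)
    have h3 := Int.le_ceil (2 ^ n * x j - 1 : ℝ)
    have h4 : ((⌊(2 ^ n * x j + 1 : ℝ)⌋ : ℤ) : ℝ) ≤ ((⌈(2 ^ n * x j - 1 : ℝ)⌉ + 2 : ℤ) : ℝ) := by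
      push_cast
      linarith
    have h5 : ⌊(2 ^ n * x j + 1 : ℝ)⌋ ≤ ⌈(2 ^ n * x j - 1 : ℝ)⌉ + 2 := by exact_mod_cast h4
    omega
  have hmem : ∀ z, x ∈ tsupport (cell n z) → z ∈ A := fun z hz => by
    rw [Fintype.mem_piFinset]
    intro j
    have h := abs_le.1 (tsupport_cell_subset n z hz j)
    rw [Finset.mem_Icc, Int.ceil_le, Int.le_floor]
    constructor <;> linarith
  have hsub : ∑ z ∈ Z ∩ A, g z = ∑ z ∈ Z, g z := by
    refine Finset.sum_subset Finset.inter_subset_left fun z hz hzA => h0 z hz fun hx => hzA ?_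
    exact Finset.mem_inter.2 ⟨hz, hmem z hx⟩
  rw [← hsub]
  have hbd : ∀ z ∈ Z ∩ A, ‖g z‖ ≤ b := fun z hz => by
    have hzZ := (Finset.mem_inter.1 hz).1
    by_cases hx : x ∈ tsupport (cell n z)
    · exact h1 z hzZ hx
    · rw [h0 z hzZ hx, norm_zero]
      exact hb
  refine (norm_sum_le_of_le _ hbd).trans ?_
  rw [Finset.sum_const, nsmul_eq_mul]
  gcongr
  exact_mod_cast (Finset.card_le_card Finset.inter_subset_right).trans hA

variable (K : Set (EuclideanSpace ℝ (Fin d)))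

open scoped Classical in
/-- The lattice points at distance at most `2 · 2^{-n}` from `K`. -/
def lattice (n : ℕ) : Finset (Fin d → ℤ) :=
  (Fintype.piFinset fun _ => Finset.Icc (-3) (2 ^ n + 3)).filter
    fun z => ∃ p ∈ K, ∀ j, |2 ^ n * p j - z j| ≤ 2

open scoped Classical in
/-- A point of `K` near the lattice point `2^{-n} z`. -/
def anchor (n : ℕ) (z : Fin d → ℤ) : EuclideanSpace ℝ (Fin d) :=
  if h : ∃ p ∈ K, ∀ j, |2 ^ n * p j - z j| ≤ 2 then h.choose else 0

variable {K}

theorem anchor_mem {n : ℕ} {z : Fin d → ℤ} (hz : z ∈ lattice K n) : anchor K n z ∈ K := by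
  classical
  have h := (Finset.mem_filter.1 hz).2
  rw [anchor, dif_pos h]
  exact h.choose_spec.1

theorem abs_anchor_le {n : ℕ} {z : Fin d → ℤ} (hz : z ∈ lattice K n) (j : Fin d) :
    |2 ^ n * anchor K n z j - z j| ≤ 2 := by
  classical
  have h := (Finset.mem_filter.1 hz).2
  rw [anchor, dif_pos h]
  exact h.choose_spec.2 j

theorem abs_anchor_sub_le {n : ℕ} {z : Fin d → ℤ} (hz : z ∈ lattice K n)
    {x : EuclideanSpace ℝ (Fin d)} (hx : x ∈ tsupport (cell n z)) (j : Fin d) :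
    |anchor K n z j - x j| ≤ 3 / 2 ^ n := by
  have h1 := abs_le.1 (abs_anchor_le hz j)
  have h2 := abs_le.1 (tsupport_cell_subset n z hx j)
  rw [le_div_iff₀ (by positivity), ← abs_of_pos (show (0 : ℝ) < 2 ^ n by positivity), ← abs_mul,
    abs_le]
  constructor <;> linarith

/-- At such an `x` every active bump is indexed by `lattice K n`: its lattice point is within 1 of
`2 ^ n * x`, which is within 1 of `2 ^ n * p`. This explains the bound 2 in `lattice`. The full sum
over a large box factors into sums of tents. -/
theorem sum_cell_eq_one (hK : ∀ x ∈ K, ∀ j, 0 ≤ x j ∧ x j ≤ 1) {n : ℕ}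
    {x : EuclideanSpace ℝ (Fin d)} (hx : ∃ p ∈ K, ∀ j, |2 ^ n * (x j - p j)| ≤ 1) :
    ∑ z ∈ lattice K n, cell n z x = 1 := by
  classical
  obtain ⟨p, hp, hxp⟩ := hx
  have hp2 : ∀ j, 0 ≤ 2 ^ n * p j ∧ 2 ^ n * p j ≤ 2 ^ n := fun j =>
    ⟨mul_nonneg (by positivity) (hK p hp j).1, mul_le_of_le_one_right (by positivity) (hK p hp j).2⟩
  have h1 : ∑ z ∈ lattice K n, cell n z x =
      ∑ z ∈ Fintype.piFinset fun _ : Fin d => Finset.Icc (-3) (2 ^ n + 3), cell n z x := by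
    refine Finset.sum_subset (Finset.filter_subset _ _) fun z hz hz' => ?_
    by_contra hne
    refine hz' (Finset.mem_filter.2 ⟨hz, p, hp, fun j => ?_⟩)
    have h2 := abs_le.1 (tsupport_cell_subset n z (subset_tsupport _ hne) j)
    have h3 := abs_le.1 (hxp j)
    rw [abs_le]
    constructor <;> linarith
  rw [h1]
  simp only [cell]
  rw [← Finset.prod_univ_sum (fun _ : Fin d => Finset.Icc (-3 : ℤ) (2 ^ n + 3))
    (fun j k => tent (2 ^ n * x j - k))]
  refine Finset.prod_eq_one fun j _ => sum_tent_eq_one ?_ ?_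
  · have h3 := abs_le.1 (hxp j)
    push_cast
    linarith [hp2 j]
  · have h3 := abs_le.1 (hxp j)
    push_cast
    linarith [hp2 j]

end FlatExtension

/-! ### Flat extension of Hölder functions -/

section FlatExtension

variable {d : ℕ} (K : Set (EuclideanSpace ℝ (Fin d))) (v : EuclideanSpace ℝ (Fin d) → ℝ)

/-- The approximation of `v` at scale `2^{-n}`. -/
def approximant (n : ℕ) (x : EuclideanSpace ℝ (Fin d)) : ℝ :=
  ∑ z ∈ lattice K n, v (anchor K n z) * cell n z x

/-- The difference of two consecutive approximations, cut off away from `K`. -/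
def increment (n : ℕ) (x : EuclideanSpace ℝ (Fin d)) : ℝ :=
  ∑ z ∈ lattice K n, ∑ z' ∈ lattice K (n + 1),
    (v (anchor K (n + 1) z') - v (anchor K n z)) * (cell n z x * cell (n + 1) z' x)

variable {K v}

theorem contDiff_approximant (n : ℕ) : ContDiff ℝ ∞ (approximant K v n) :=
  ContDiff.sum fun z _ => contDiff_const.mul (contDiff_cell n z)

theorem contDiff_increment (n : ℕ) : ContDiff ℝ ∞ (increment K v n) :=
  ContDiff.sum fun z _ => ContDiff.sum fun z' _ =>
    contDiff_const.mul ((contDiff_cell n z).mul (contDiff_cell (n + 1) z'))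

/-- Near `K` the bumps of both scales sum to 1; multiplying each approximation by the other
partition of unity gives the double sum. -/
theorem increment_eq (hK : ∀ x ∈ K, ∀ j, 0 ≤ x j ∧ x j ≤ 1) {n : ℕ}
    {x : EuclideanSpace ℝ (Fin d)} (hx : ∃ p ∈ K, ∀ j, |2 ^ (n + 1) * (x j - p j)| ≤ 1) :
    increment K v n x = approximant K v (n + 1) x - approximant K v n x := by
  have h1 := sum_cell_eq_one hK hx
  have h0 : ∑ z ∈ lattice K n, cell n z x = 1 := by
    refine sum_cell_eq_one hK ?_
    obtain ⟨p, hp, h⟩ := hx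
    refine ⟨p, hp, fun j => le_trans ?_ (h j)⟩
    rw [abs_mul, abs_mul]
    refine mul_le_mul_of_nonneg_right ?_ (abs_nonneg _)
    rw [abs_of_pos (by positivity), abs_of_pos (by positivity)]
    exact pow_le_pow_right₀ (by norm_num) (Nat.le_succ n)
  have e1 : approximant K v (n + 1) x = ∑ z ∈ lattice K n, ∑ z' ∈ lattice K (n + 1),
      v (anchor K (n + 1) z') * (cell n z x * cell (n + 1) z' x) := by
    calc approximant K v (n + 1) x =
          (∑ z ∈ lattice K n, cell n z x) * approximant K v (n + 1) x := by rw [h0, one_mul]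
      _ = _ := by
          rw [approximant, Finset.sum_mul_sum]
          exact Finset.sum_congr rfl fun z _ => Finset.sum_congr rfl fun z' _ => by ring
  have e0 : approximant K v n x = ∑ z ∈ lattice K n, ∑ z' ∈ lattice K (n + 1),
      v (anchor K n z) * (cell n z x * cell (n + 1) z' x) := by
    calc approximant K v n x =
          approximant K v n x * ∑ z ∈ lattice K (n + 1), cell (n + 1) z x := by rw [h1, mul_one]
      _ = _ := by
          rw [approximant, Finset.sum_mul_sum]
          exact Finset.sum_congr rfl fun z _ => Finset.sum_congr rfl fun z' _ => by ring
  rw [e1, e0, increment, ← Finset.sum_sub_distrib]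
  refine Finset.sum_congr rfl fun z _ => ?_
  rw [← Finset.sum_sub_distrib]
  exact Finset.sum_congr rfl fun z' _ => by ring

theorem iteratedFDeriv_cell_eq_zero {n i : ℕ} {z : Fin d → ℤ} {x : EuclideanSpace ℝ (Fin d)}
    (hx : x ∉ tsupport (cell n z)) : iteratedFDeriv ℝ i (cell n z) x = 0 :=
  image_eq_zero_of_notMem_tsupport fun h => hx (tsupport_iteratedFDeriv_subset i h)

/-- When two bumps of consecutive scales are active at the same point, near `K` or not, their
anchors are two points of `K` at distance `O(2 ^ (-n))`. The coefficient is thus `O(2 ^ (-β * n))`,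
and differentiating the bumps `i` times costs `2 ^ (i * n)`. -/
theorem exists_bound_increment {β C : ℝ} (hβ : 0 < β) (hC : 0 ≤ C)
    (hv : ∀ x ∈ K, ∀ y ∈ K, |v x - v y| ≤ C * ‖x - y‖ ^ β) (N : ℕ) :
    ∃ A : ℝ, 0 ≤ A ∧ ∀ n, ∀ i ≤ N, ∀ x,
      ‖iteratedFDeriv ℝ i (increment K v n) x‖ ≤ A * (2 ^ i * 2 ^ (-β)) ^ n := by
  obtain ⟨A, hA0, hA⟩ := exists_bound_iteratedFDeriv_cell d N
  -- The factors `3 ^ d` count active bumps at the two scales, and `6 = 3 + 3` bounds the distance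
  -- of the anchors through `x`. In `4 ^ N` one power of 2 is the sum of binomial coefficients, the
  -- other comes from the finer scale `n + 1`.
  refine ⟨3 ^ d * (3 ^ d * (C * (d * 6) ^ β * (4 ^ N * A ^ 2))), by positivity,
    fun n i hi x => ?_⟩
  have hi' : (i : WithTop ℕ∞) ≤ ∞ := by exact_mod_cast le_top
  have hprod : ∀ z z' : Fin d → ℤ, ContDiff ℝ ∞ fun y => cell n z y * cell (n + 1) z' y := fun z z' =>
    (contDiff_cell n z).mul (contDiff_cell (n + 1) z')
  have e : iteratedFDeriv ℝ i (increment K v n) x = ∑ z ∈ lattice K n,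
      ∑ z' ∈ lattice K (n + 1), (v (anchor K (n + 1) z') - v (anchor K n z)) •
        iteratedFDeriv ℝ i (fun y => cell n z y * cell (n + 1) z' y) x := by
    unfold increment
    rw [iteratedFDeriv_fun_sum_apply fun z _ => (ContDiff.sum fun z' _ =>
      contDiff_const.mul (hprod z z')).contDiffAt.of_le hi']
    refine Finset.sum_congr rfl fun z _ => ?_
    rw [iteratedFDeriv_fun_sum_apply fun z' _ =>
      (contDiff_const.mul (hprod z z')).contDiffAt.of_le hi']
    refine Finset.sum_congr rfl fun z' _ => ?_
    exact iteratedFDeriv_const_smul_apply' (a := v (anchor K (n + 1) z') - v (anchor K n z))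
      ((hprod z z').contDiffAt.of_le hi')
  have hnorm : ∀ z z' : Fin d → ℤ, ‖iteratedFDeriv ℝ i (fun y => cell n z y * cell (n + 1) z' y) x‖ ≤
      4 ^ N * A ^ 2 * (2 ^ i) ^ n := by
    intro z z'
    refine (norm_iteratedFDeriv_mul_le (contDiff_cell n z) (contDiff_cell (n + 1) z') x hi').trans ?_
    calc ∑ j ∈ Finset.range (i + 1), (i.choose j : ℝ) * ‖iteratedFDeriv ℝ j (cell n z) x‖ *
          ‖iteratedFDeriv ℝ (i - j) (cell (n + 1) z') x‖
        ≤ ∑ j ∈ Finset.range (i + 1), (i.choose j : ℝ) * (A ^ 2 * (2 ^ (n + 1)) ^ i) := by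
          refine Finset.sum_le_sum fun j hj => ?_
          have hj' : j ≤ i := Nat.lt_succ_iff.1 (Finset.mem_range.1 hj)
          rw [mul_assoc]
          refine mul_le_mul_of_nonneg_left ?_ (by positivity)
          calc ‖iteratedFDeriv ℝ j (cell n z) x‖ * ‖iteratedFDeriv ℝ (i - j) (cell (n + 1) z') x‖
              ≤ (A * (2 ^ (n + 1)) ^ j) * (A * (2 ^ (n + 1)) ^ (i - j)) := by
                gcongr
                · refine (hA n z j (hj'.trans hi) x).trans ?_
                  gcongr
                  · norm_num
                  · omega
                · exact hA (n + 1) z' (i - j) (by omega) x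
            _ = A ^ 2 * (2 ^ (n + 1)) ^ i := by
                rw [mul_mul_mul_comm, ← pow_add, Nat.add_sub_cancel' hj']
                ring
      _ = 4 ^ i * A ^ 2 * (2 ^ i) ^ n := by
          rw [← Finset.sum_mul]
          have : ∑ j ∈ Finset.range (i + 1), (i.choose j : ℝ) = 2 ^ i := by
            exact_mod_cast Nat.sum_range_choose i
          rw [this, ← pow_mul, ← pow_mul, show (4 : ℝ) = 2 * 2 by norm_num, mul_pow]
          ring
      _ ≤ 4 ^ N * A ^ 2 * (2 ^ i) ^ n := by
          gcongr
          norm_num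
  have hbeta : (2 : ℝ) ^ (-β) = ((2 : ℝ) ^ β)⁻¹ := Real.rpow_neg (by norm_num) β
  have hval : ∀ z ∈ lattice K n, ∀ z' ∈ lattice K (n + 1), x ∈ tsupport (cell n z) →
      x ∈ tsupport (cell (n + 1) z') →
      |v (anchor K (n + 1) z') - v (anchor K n z)| ≤ C * (d * 6) ^ β * (2 ^ (-β)) ^ n := by
    intro z hz z' hz' hx hx'
    refine (hv _ (anchor_mem hz') _ (anchor_mem hz)).trans ?_
    have h1 : ‖anchor K (n + 1) z' - anchor K n z‖ ≤ d * (6 / 2 ^ n) := by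
      refine norm_le_of_forall_abs_le (by positivity) fun j => ?_
      have h2 := abs_le.1 (abs_anchor_sub_le hz hx j)
      have h3 := abs_le.1 (abs_anchor_sub_le hz' hx' j)
      have h4 : (3 : ℝ) / 2 ^ (n + 1) ≤ 3 / 2 ^ n := by
        gcongr
        · norm_num
        · omega
      have h5 : (6 : ℝ) / 2 ^ n = 3 / 2 ^ n + 3 / 2 ^ n := by ring
      rw [PiLp.sub_apply, abs_le]
      constructor <;> linarith
    have h6 : ‖anchor K (n + 1) z' - anchor K n z‖ ^ β ≤ (d * (6 / 2 ^ n)) ^ β :=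
      Real.rpow_le_rpow (norm_nonneg _) h1 hβ.le
    have h7 : ((d : ℝ) * (6 / 2 ^ n)) ^ β = (d * 6) ^ β * (2 ^ (-β)) ^ n := by
      rw [← mul_div_assoc, Real.div_rpow (by positivity) (by positivity), hbeta, inv_pow,
        div_eq_mul_inv, ← Real.rpow_natCast 2 n, ← Real.rpow_mul (by norm_num), mul_comm (n : ℝ),
        Real.rpow_mul (by norm_num), Real.rpow_natCast]
    rw [mul_assoc, ← h7]
    gcongr
  have hzero : ∀ z z' : Fin d → ℤ, x ∉ tsupport (cell n z) ∨ x ∉ tsupport (cell (n + 1) z') →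
      iteratedFDeriv ℝ i (fun y => cell n z y * cell (n + 1) z' y) x = 0 := by
    intro z z' h
    refine image_eq_zero_of_notMem_tsupport fun hmem => ?_
    have hmem' := tsupport_iteratedFDeriv_subset i hmem
    rcases h with h | h
    · exact h (tsupport_mul_subset_left hmem')
    · exact h (tsupport_mul_subset_right hmem')
  rw [e, mul_pow, mul_assoc, mul_assoc]
  refine norm_sum_le_of_active _ _ n x (by positivity) (fun z _ hz => ?_) fun z hzl hz => ?_
  · refine Finset.sum_eq_zero fun z' _ => ?_
    rw [hzero z z' (Or.inl hz), smul_zero]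
  · refine norm_sum_le_of_active _ _ (n + 1) x (by positivity) (fun z' _ hz' => ?_)
      fun z' hzl' hz' => ?_
    · rw [hzero z z' (Or.inr hz'), smul_zero]
    · rw [norm_smul, Real.norm_eq_abs]
      calc |v (anchor K (n + 1) z') - v (anchor K n z)| *
            ‖iteratedFDeriv ℝ i (fun y => cell n z y * cell (n + 1) z' y) x‖
          ≤ (C * (d * 6) ^ β * (2 ^ (-β)) ^ n) * (4 ^ N * A ^ 2 * (2 ^ i) ^ n) := by
            gcongr
            · exact hval z hzl z' hzl' hz hz'
            · exact hnorm z z'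
        _ = _ := by ring

/-- Near a point `x` of `K` the bumps sum to 1 and their differentials to 0, so `v x` can be
subtracted from every coefficient. What remains is `O(2 ^ (-β * n))`, and the differential costs one
factor `2 ^ n`. -/
theorem exists_bound_approximant_sub {β C : ℝ} (hβ : 0 < β) (hC : 0 ≤ C)
    (hK : ∀ x ∈ K, ∀ j, 0 ≤ x j ∧ x j ≤ 1)
    (hv : ∀ x ∈ K, ∀ y ∈ K, |v x - v y| ≤ C * ‖x - y‖ ^ β) :
    ∃ A : ℝ, 0 ≤ A ∧ ∀ n, ∀ x ∈ K, |approximant K v n x - v x| ≤ A * (2 ^ (-β)) ^ n ∧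
      ‖fderiv ℝ (approximant K v n) x‖ ≤ A * (2 * 2 ^ (-β)) ^ n := by
  obtain ⟨A, hA0, hA⟩ := exists_bound_iteratedFDeriv_cell d 1
  refine ⟨3 ^ d * (C * (d * 3) ^ β * A), by positivity, fun n x hx => ?_⟩
  have hbeta : (2 : ℝ) ^ (-β) = ((2 : ℝ) ^ β)⁻¹ := Real.rpow_neg (by norm_num) β
  have hval : ∀ z ∈ lattice K n, x ∈ tsupport (cell n z) →
      |v (anchor K n z) - v x| ≤ C * (d * 3) ^ β * (2 ^ (-β)) ^ n := by
    intro z hz hxz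
    refine (hv _ (anchor_mem hz) _ hx).trans ?_
    have h1 : ‖anchor K n z - x‖ ≤ d * (3 / 2 ^ n) :=
      norm_le_of_forall_abs_le (by positivity) fun j => abs_anchor_sub_le hz hxz j
    have h6 : ‖anchor K n z - x‖ ^ β ≤ (d * (3 / 2 ^ n)) ^ β :=
      Real.rpow_le_rpow (norm_nonneg _) h1 hβ.le
    have h7 : ((d : ℝ) * (3 / 2 ^ n)) ^ β = (d * 3) ^ β * (2 ^ (-β)) ^ n := by
      rw [← mul_div_assoc, Real.div_rpow (by positivity) (by positivity), hbeta, inv_pow,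
        div_eq_mul_inv, ← Real.rpow_natCast 2 n, ← Real.rpow_mul (by norm_num), mul_comm (n : ℝ),
        Real.rpow_mul (by norm_num), Real.rpow_natCast]
    rw [mul_assoc, ← h7]
    gcongr
  have hone : ∀ᶠ y in 𝓝 x, ∑ z ∈ lattice K n, cell n z y = 1 := by
    have : ∀ᶠ y in 𝓝 x, ∀ j : Fin d, |2 ^ n * (y j - x j)| < 1 := by
      rw [eventually_all]
      intro j
      have hcont : Continuous fun y : EuclideanSpace ℝ (Fin d) => |2 ^ n * (y j - x j)| :=
        (continuous_const.mul ((EuclideanSpace.proj (𝕜 := ℝ) j).continuous.sub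
          continuous_const)).abs
      refine hcont.continuousAt.eventually_lt continuousAt_const ?_
      simp
    filter_upwards [this] with y hy
    exact sum_cell_eq_one hK ⟨x, hx, fun j => (hy j).le⟩
  constructor
  · have e : approximant K v n x - v x =
        ∑ z ∈ lattice K n, (v (anchor K n z) - v x) * cell n z x := by
      simp only [sub_mul, Finset.sum_sub_distrib]
      rw [← Finset.mul_sum, hone.self_of_nhds, mul_one, approximant]
    rw [e, ← Real.norm_eq_abs, mul_assoc]
    refine norm_sum_le_of_active _ _ n x (by positivity) (fun z _ hz => ?_) fun z hzl hz => ?_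
    · rw [image_eq_zero_of_notMem_tsupport hz, mul_zero]
    · have h1 := hA n z 0 (by norm_num) x
      rw [norm_iteratedFDeriv_zero, pow_zero, mul_one] at h1
      rw [norm_mul, Real.norm_eq_abs]
      calc |v (anchor K n z) - v x| * ‖cell n z x‖
          ≤ (C * (d * 3) ^ β * (2 ^ (-β)) ^ n) * A := by
            gcongr
            exact hval z hzl hz
        _ = _ := by ring
  · have hdc : ∀ z, DifferentiableAt ℝ (cell n z) x := fun z =>
      (contDiff_cell n z).contDiffAt.differentiableAt (by simp)
    have h0 : ∑ z ∈ lattice K n, fderiv ℝ (cell n z) x = 0 := by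
      rw [← fderiv_fun_sum fun z _ => hdc z]
      have : (fun y => ∑ z ∈ lattice K n, cell n z y) =ᶠ[𝓝 x] fun _ => (1 : ℝ) := hone
      rw [this.fderiv_eq, fderiv_const_apply]
    have e : fderiv ℝ (approximant K v n) x =
        ∑ z ∈ lattice K n, (v (anchor K n z) - v x) • fderiv ℝ (cell n z) x := by
      simp only [sub_smul, Finset.sum_sub_distrib]
      rw [← Finset.smul_sum, h0, smul_zero, sub_zero]
      unfold approximant
      rw [fderiv_fun_sum fun z _ => (hdc z).const_mul _]
      exact Finset.sum_congr rfl fun z _ => fderiv_const_mul (hdc z) _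
    rw [e, mul_assoc]
    refine norm_sum_le_of_active _ _ n x (by positivity) (fun z _ hz => ?_) fun z hzl hz => ?_
    · have := iteratedFDeriv_cell_eq_zero (i := 1) hz
      rw [← norm_eq_zero, norm_iteratedFDeriv_one, norm_eq_zero] at this
      rw [this, smul_zero]
    · have h1 := hA n z 1 le_rfl x
      rw [norm_iteratedFDeriv_one, pow_one] at h1
      rw [norm_smul, Real.norm_eq_abs]
      calc |v (anchor K n z) - v x| * ‖fderiv ℝ (cell n z) x‖
          ≤ (C * (d * 3) ^ β * (2 ^ (-β)) ^ n) * (A * 2 ^ n) := by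
            gcongr
            exact hval z hzl hz
        _ = _ := by rw [mul_pow]; ring

theorem abs_le_of_mem_tsupport_cell (hK : ∀ x ∈ K, ∀ j, 0 ≤ x j ∧ x j ≤ 1) {n : ℕ}
    {z : Fin d → ℤ} (hz : z ∈ lattice K n) {x : EuclideanSpace ℝ (Fin d)}
    (hx : cell n z x ≠ 0) (j : Fin d) : |x j| ≤ 4 := by
  have h1 := abs_le.1 (abs_anchor_sub_le hz (subset_tsupport _ hx) j)
  have h2 := hK _ (anchor_mem hz) j
  have h3 : (3 : ℝ) / 2 ^ n ≤ 3 := div_le_self (by norm_num) (one_le_pow₀ (by norm_num))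
  rw [abs_le]
  constructor <;> linarith

/-- The terms of the series for the flat extension. -/
def extensionTerm (K : Set (EuclideanSpace ℝ (Fin d))) (v : EuclideanSpace ℝ (Fin d) → ℝ) :
    ℕ → EuclideanSpace ℝ (Fin d) → ℝ
  | 0 => approximant K v 0
  | n + 1 => increment K v n

/-- The partial sums telescope on the dyadic neighbourhood of `K` where every increment so far is a
true difference. -/
theorem sum_extensionTerm (hK : ∀ x ∈ K, ∀ j, 0 ≤ x j ∧ x j ≤ 1) (n : ℕ)
    {x : EuclideanSpace ℝ (Fin d)} (hx : ∃ p ∈ K, ∀ j, |2 ^ n * (x j - p j)| ≤ 1) :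
    ∑ i ∈ Finset.range (n + 1), extensionTerm K v i x = approximant K v n x := by
  induction n with
  | zero => simp [extensionTerm]
  | succ n ih =>
    have hx' : ∃ p ∈ K, ∀ j, |2 ^ n * (x j - p j)| ≤ 1 := by
      obtain ⟨p, hp, h⟩ := hx
      refine ⟨p, hp, fun j => le_trans ?_ (h j)⟩
      rw [abs_mul, abs_mul]
      refine mul_le_mul_of_nonneg_right ?_ (abs_nonneg _)
      rw [abs_of_pos (by positivity), abs_of_pos (by positivity)]
      exact pow_le_pow_right₀ (by norm_num) (Nat.le_succ n)
    rw [Finset.sum_range_succ, ih hx', extensionTerm, increment_eq hK hx]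
    ring

theorem contDiff_extensionTerm : ∀ n, ContDiff ℝ ∞ (extensionTerm K v n)
  | 0 => contDiff_approximant 0
  | n + 1 => contDiff_increment n

theorem hasCompactSupport_approximant (hK : ∀ x ∈ K, ∀ j, 0 ≤ x j ∧ x j ≤ 1) (n : ℕ) :
    HasCompactSupport (approximant K v n) := by
  refine HasCompactSupport.of_support_subset_isCompact
    (isCompact_closedBall (0 : EuclideanSpace ℝ (Fin d)) (d * 4)) fun x hx => ?_
  rw [mem_closedBall_zero_iff]
  obtain ⟨z, hz, h⟩ := Finset.exists_ne_zero_of_sum_ne_zero hx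
  exact norm_le_of_forall_abs_le (by norm_num)
    (abs_le_of_mem_tsupport_cell hK hz (right_ne_zero_of_mul h))

theorem exists_bound_extensionTerm {β C : ℝ} (hβ : 0 < β) (hC : 0 ≤ C)
    (hK : ∀ x ∈ K, ∀ j, 0 ≤ x j ∧ x j ≤ 1)
    (hv : ∀ x ∈ K, ∀ y ∈ K, |v x - v y| ≤ C * ‖x - y‖ ^ β) (N : ℕ) :
    ∃ A : ℝ, ∀ n, ∀ i ≤ N, ∀ x,
      ‖iteratedFDeriv ℝ i (extensionTerm K v n) x‖ ≤ A * (2 ^ i * 2 ^ (-β)) ^ n := by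
  obtain ⟨A, hA0, hA⟩ := exists_bound_increment hβ hC hv N
  have hb : ∀ i : ℕ, ∃ C, ∀ y, ‖iteratedFDeriv ℝ i (approximant K v 0) y‖ ≤ C := fun i =>
    ((contDiff_approximant 0).continuous_iteratedFDeriv
      (by exact_mod_cast le_top)).bounded_above_of_compact_support
        ((hasCompactSupport_approximant hK 0).iteratedFDeriv i)
  choose B hB using hb
  have hB0 : ∀ i, 0 ≤ B i := fun i => (norm_nonneg _).trans (hB i 0)
  have hBs : 0 ≤ ∑ i ∈ Finset.range (N + 1), B i := Finset.sum_nonneg fun i _ => hB0 i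
  have hq : (0 : ℝ) < 2 ^ (-β) := by positivity
  refine ⟨(∑ i ∈ Finset.range (N + 1), B i) + A / 2 ^ (-β), fun n i hi x => ?_⟩
  cases n with
  | zero =>
    have h1 : B i ≤ ∑ i ∈ Finset.range (N + 1), B i :=
      Finset.single_le_sum (fun j _ => hB0 j) (Finset.mem_range.2 (by omega))
    have h2 : 0 ≤ A / 2 ^ (-β) := by positivity
    rw [pow_zero, mul_one]
    exact (hB i x).trans (by linarith)
  | succ n =>
    refine (hA n i hi x).trans ?_
    -- Term `n + 1` is the increment of index `n`; the shift of the exponent is paid for by dividing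
    -- by `2 ^ (-β)`, since `2 ^ i ≥ 1`.
    have h1 : A * (2 ^ i * 2 ^ (-β)) ^ n ≤ A / 2 ^ (-β) * (2 ^ i * 2 ^ (-β)) ^ (n + 1) := by
      have h2 : A / 2 ^ (-β) * (2 ^ i * 2 ^ (-β)) ^ (n + 1) =
          2 ^ i * (A * (2 ^ i * 2 ^ (-β)) ^ n) := by
        rw [pow_succ]
        field_simp
      rw [h2]
      exact le_mul_of_one_le_left (by positivity) (one_le_pow₀ (by norm_num))
    have h3 : 0 ≤ (∑ i ∈ Finset.range (N + 1), B i) * (2 ^ i * 2 ^ (-β)) ^ (n + 1) := by positivity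
    rw [add_mul]
    linarith

theorem eq_zero_of_extensionTerm_ne_zero (hK : ∀ x ∈ K, ∀ j, 0 ≤ x j ∧ x j ≤ 1) {n : ℕ}
    {x : EuclideanSpace ℝ (Fin d)} (h : extensionTerm K v n x ≠ 0) : ‖x‖ ≤ d * 4 := by
  refine norm_le_of_forall_abs_le (by norm_num) fun j => ?_
  cases n with
  | zero =>
    obtain ⟨z, hz, h⟩ := Finset.exists_ne_zero_of_sum_ne_zero h
    exact abs_le_of_mem_tsupport_cell hK hz (right_ne_zero_of_mul h) j
  | succ n =>
    obtain ⟨z, hz, h⟩ := Finset.exists_ne_zero_of_sum_ne_zero h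
    obtain ⟨z', hz', h⟩ := Finset.exists_ne_zero_of_sum_ne_zero h
    exact abs_le_of_mem_tsupport_cell hK hz
      (left_ne_zero_of_mul (right_ne_zero_of_mul h)) j

/-- A function on `K` that is Hölder continuous of exponent `β > 1` extends to a function on `ℝ^d`
whose differential vanishes on `K`. -/
theorem exists_flat_extension {β C : ℝ} (hβ : 1 < β) (hC : 0 ≤ C)
    (hK : ∀ x ∈ K, ∀ j, 0 ≤ x j ∧ x j ≤ 1)
    (hv : ∀ x ∈ K, ∀ y ∈ K, |v x - v y| ≤ C * ‖x - y‖ ^ β) {N : ℕ} (hN : 1 ≤ N) :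
    ∃ F : EuclideanSpace ℝ (Fin d) → ℝ, IsDyadicSeries (2 ^ (-β)) N F ∧
      (∀ x, F x ≠ 0 → ‖x‖ ≤ d * 4) ∧ (∀ x ∈ K, F x = v x) ∧
      ∀ x ∈ K, HasFDerivAt F (0 : EuclideanSpace ℝ (Fin d) →L[ℝ] ℝ) x := by
  have hβ0 : 0 < β := by linarith
  obtain ⟨A, hA⟩ := exists_bound_extensionTerm hβ0 hC hK hv N
  obtain ⟨A', hA'0, hA'⟩ := exists_bound_approximant_sub hβ0 hC hK hv
  have hq : (0 : ℝ) < 2 ^ (-β) := by positivity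
  -- This is where `β > 1` enters: the differentials of the approximations tend to 0 on `K`.
  have h2q : 2 * (2 : ℝ) ^ (-β) < 1 := by
    rw [Real.rpow_neg (by norm_num), mul_inv_lt_iff₀ (by positivity), one_mul]
    conv_lhs => rw [← Real.rpow_one 2]
    exact Real.rpow_lt_rpow_of_exponent_lt (by norm_num) hβ
  have hs0 : ∀ x, Summable fun n => extensionTerm K v n x := fun x => by
    refine .of_norm_bounded ((summable_geometric_of_lt_one hq.le (by linarith)).mul_left A)
      fun n => ?_
    have := hA n 0 (Nat.zero_le _) x
    rwa [norm_iteratedFDeriv_zero, pow_zero, one_mul] at this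
  have hs1 : Summable fun n => A * (2 * (2 : ℝ) ^ (-β)) ^ n :=
    (summable_geometric_of_lt_one (by positivity) h2q).mul_left A
  have hb1 : ∀ n x, ‖fderiv ℝ (extensionTerm K v n) x‖ ≤ A * (2 * (2 : ℝ) ^ (-β)) ^ n :=
    fun n x => by
    have := hA n 1 hN x
    rwa [norm_iteratedFDeriv_one, pow_one] at this
  have hdiff : ∀ n x, DifferentiableAt ℝ (extensionTerm K v n) x := fun n x =>
    (contDiff_extensionTerm n).contDiffAt.differentiableAt (by simp)
  refine ⟨fun x => ∑' n, extensionTerm K v n x,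
    ⟨extensionTerm K v, A, contDiff_extensionTerm, hA, fun x => rfl⟩, fun x hx => ?_,
    fun x hx => ?_, fun x hx => ?_⟩
  · obtain ⟨n, hn⟩ : ∃ n, extensionTerm K v n x ≠ 0 := by
      by_contra! h
      exact hx (by simp [h])
    exact eq_zero_of_extensionTerm_ne_zero hK hn
  · have h1 : Tendsto (fun n => ∑ i ∈ Finset.range (n + 1), extensionTerm K v i x) atTop
        (𝓝 (∑' n, extensionTerm K v n x)) :=
      (hs0 x).hasSum.tendsto_sum_nat.comp (tendsto_add_atTop_nat 1)
    have h2 : Tendsto (fun n => ∑ i ∈ Finset.range (n + 1), extensionTerm K v i x) atTop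
        (𝓝 (v x)) := by
      rw [tendsto_iff_norm_sub_tendsto_zero]
      have h3 : Tendsto (fun n : ℕ => A' * ((2 : ℝ) ^ (-β)) ^ n) atTop (𝓝 (A' * 0)) :=
        (tendsto_pow_atTop_nhds_zero_of_lt_one hq.le (by linarith)).const_mul A'
      rw [mul_zero] at h3
      refine squeeze_zero (fun n => norm_nonneg _) (fun n => ?_) h3
      rw [sum_extensionTerm hK n ⟨x, hx, fun j => by simp⟩]
      exact (hA' n x hx).1
    exact tendsto_nhds_unique h1 h2
  · have h1 := hasFDerivAt_tsum hs1 (fun n x => (hdiff n x).hasFDerivAt) hb1 (hs0 0) x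
    have hsf : Summable fun n => fderiv ℝ (extensionTerm K v n) x :=
      .of_norm_bounded hs1 fun n => hb1 n x
    have h2 : Tendsto (fun n => ∑ i ∈ Finset.range (n + 1), fderiv ℝ (extensionTerm K v i) x) atTop
        (𝓝 (∑' n, fderiv ℝ (extensionTerm K v n) x)) :=
      hsf.hasSum.tendsto_sum_nat.comp (tendsto_add_atTop_nat 1)
    have h3 : Tendsto (fun n => ∑ i ∈ Finset.range (n + 1), fderiv ℝ (extensionTerm K v i) x) atTop
        (𝓝 0) := by
      rw [tendsto_zero_iff_norm_tendsto_zero]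
      have h3 : Tendsto (fun n : ℕ => A' * (2 * (2 : ℝ) ^ (-β)) ^ n) atTop (𝓝 (A' * 0)) :=
        (tendsto_pow_atTop_nhds_zero_of_lt_one (by positivity) h2q).const_mul A'
      rw [mul_zero] at h3
      refine squeeze_zero (fun n => norm_nonneg _) (fun n => ?_) h3
      -- Equality on a whole neighbourhood of `x`, not only on `K`, is what identifies the
      -- differentials.
      have h4 : (fun y => ∑ i ∈ Finset.range (n + 1), extensionTerm K v i y) =ᶠ[𝓝 x]
          approximant K v n := by
        have : ∀ᶠ y in 𝓝 x, ∀ j : Fin d, |2 ^ n * (y j - x j)| < 1 := by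
          rw [eventually_all]
          intro j
          have hcont : Continuous fun y : EuclideanSpace ℝ (Fin d) => |2 ^ n * (y j - x j)| :=
            (continuous_const.mul ((EuclideanSpace.proj (𝕜 := ℝ) j).continuous.sub
              continuous_const)).abs
          refine hcont.continuousAt.eventually_lt continuousAt_const ?_
          simp
        filter_upwards [this] with y hy
        exact sum_extensionTerm hK n ⟨x, hx, fun j => (hy j).le⟩
      rw [← fderiv_fun_sum fun i _ => hdiff i x, h4.fderiv_eq]
      exact (hA' n x hx).2
    rwa [tendsto_nhds_unique h2 h3] at h1

/-- For `1 < β < d` there is a function on `ℝ^d`, with compact support and as regular as a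
function of class `C^β`, that is not constant on a compact connected set of critical points. -/
theorem exists_whitney_function {β : ℝ} (hβ : 1 < β) (hβd : β < d) :
    ∃ (K : Set (EuclideanSpace ℝ (Fin d))) (F : EuclideanSpace ℝ (Fin d) → ℝ),
      IsCompact K ∧ IsConnected K ∧ IsDyadicSeries (2 ^ (-β)) d F ∧
      (∀ x, F x ≠ 0 → ‖x‖ ≤ d * 4) ∧ (∀ x ∈ K, ‖x‖ ≤ d * 4) ∧
      (∀ x ∈ K, HasFDerivAt F (0 : EuclideanSpace ℝ (Fin d) →L[ℝ] ℝ) x) ∧ ∃ x ∈ K, ∃ y ∈ K, F x ≠ F y := by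
  obtain ⟨K, v, hKc, hKcon, hK, ⟨x, hx, y, hy, hxy⟩, C, hC⟩ :=
    exists_fractal_height (by linarith) hβd
  have hd : 1 ≤ d := by
    have h : (1 : ℝ) < d := hβ.trans hβd
    exact_mod_cast h.le
  obtain ⟨F, hF, hF0, hFv, hFd⟩ := exists_flat_extension hβ (abs_nonneg C) hK
    (fun x hx y hy => (hC x hx y hy).trans (by gcongr; exact le_abs_self C)) hd
  refine ⟨K, F, hKc, hKcon, hF, hF0, fun x hx => ?_, hFd, x, hx, y, hy, by rwa [hFv x hx, hFv y hy]⟩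
  refine norm_le_of_forall_abs_le (by norm_num) fun j => ?_
  have h := hK x hx j
  rw [abs_le]
  constructor <;> linarith

end FlatExtension

/-! ### Riemannian metrics and smoothness of the conorm -/

section Metric

theorem isInvertible_of_pos {V : Type*} [NormedAddCommGroup V] [NormedSpace ℝ V]
    [FiniteDimensional ℝ V] (B : V →L[ℝ] V →L[ℝ] ℝ) (hB : ∀ v, v ≠ 0 → 0 < B v v) :
    B.IsInvertible := by
  have hinj : Function.Injective (B : V →ₗ[ℝ] V →L[ℝ] ℝ) := by
    rw [← LinearMap.ker_eq_bot, LinearMap.ker_eq_bot']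
    intro v hv
    by_contra hne
    have h := hB v hne
    have h0 : B v = 0 := hv
    simp [h0] at h
  have hdim : Module.finrank ℝ V = Module.finrank ℝ (V →L[ℝ] ℝ) :=
    (Subspace.dual_finrank_eq (K := ℝ) (V := V)).symm.trans
      (LinearMap.toContinuousLinearMap (𝕜 := ℝ) (E := V) (F' := ℝ)).finrank_eq
  exact ⟨(LinearEquiv.ofInjectiveOfFinrankEq _ hinj hdim).toContinuousLinearEquiv, by ext; rfl⟩

theorem inverse_eq_of_pos {V : Type*} [NormedAddCommGroup V] [NormedSpace ℝ V]
    [FiniteDimensional ℝ V] (B : V →L[ℝ] V →L[ℝ] ℝ) (hB : ∀ v, v ≠ 0 → 0 < B v v) {v : V}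
    {p : V →L[ℝ] ℝ} (h : B v = p) : ContinuousLinearMap.inverse B p = v := by
  by_contra hne
  have h1 := hB _ (sub_ne_zero.2 hne)
  rw [map_sub B, apply_inverse_of_pos B hB, h, sub_self] at h1
  exact lt_irrefl _ h1

/-- The minimum `c > 0` of the form on the unit sphere gives `c * ‖v‖ ^ 2 ≤ B v v` by homogeneity.
-/
theorem isVonNBounded_of_pos {V : Type*} [NormedAddCommGroup V] [NormedSpace ℝ V]
    [FiniteDimensional ℝ V] (B : V →L[ℝ] V →L[ℝ] ℝ) (hB : ∀ v, v ≠ 0 → 0 < B v v) :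
    Bornology.IsVonNBounded ℝ {v | B v v < 1} := by
  rw [NormedSpace.isVonNBounded_iff]
  have hcont : Continuous fun v => B v v := by fun_prop
  rcases subsingleton_or_nontrivial V with hV | hV
  · exact Bornology.IsBounded.all _ 
  obtain ⟨v₀, hv₀, hmin⟩ := (isCompact_sphere (0 : V) 1).exists_isMinOn
    (NormedSpace.sphere_nonempty.2 zero_le_one) hcont.continuousOn
  have hv₀' : v₀ ≠ 0 := by
    rintro rfl
    simp at hv₀
  set c := B v₀ v₀ with hc
  have hc0 : 0 < c := hB v₀ hv₀'
  have hlow : ∀ v, c * ‖v‖ ^ 2 ≤ B v v := by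
    intro v
    by_cases hv : v = 0
    · simp [hv]
    have hn : 0 < ‖v‖ := norm_pos_iff.2 hv
    have h1 : c ≤ B (‖v‖⁻¹ • v) (‖v‖⁻¹ • v) := hmin (by simp [norm_smul, hn.ne'])
    simp only [map_smul, smul_apply, smul_eq_mul] at h1
    calc c * ‖v‖ ^ 2 ≤ (‖v‖⁻¹ * (‖v‖⁻¹ * B v v)) * ‖v‖ ^ 2 := by gcongr
      _ = B v v := by field_simp
  refine (Metric.isBounded_closedBall (x := (0 : V)) (r := 1 + 1 / c)).subset fun v hv => ?_
  rw [mem_closedBall_zero_iff]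
  have h1 : c * ‖v‖ ^ 2 < 1 := (hlow v).trans_lt hv
  have h2 : ‖v‖ ^ 2 < 1 / c := by rwa [lt_div_iff₀ hc0, mul_comm]
  nlinarith [sq_nonneg (‖v‖ - 1)]

variable {d : ℕ} {M : Type*} [TopologicalSpace M] [ChartedSpace (Model d) M]
  [IsManifold (𝓡 d) ∞ M]

theorem bilin_inCoordinates_apply {q₀ q : M}
    (hq : q ∈ (trivializationAt (Model d) (TangentSpace (𝓡 d)) q₀).baseSet)
    (B : TangentSpace (𝓡 d) q →L[ℝ] TangentSpace (𝓡 d) q →L[ℝ] ℝ) (v w : Model d) :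
    ContinuousLinearMap.inCoordinates (Model d) (TangentSpace (𝓡 d) : M → Type _)
      (Model d →L[ℝ] ℝ) (fun q : M => TangentSpace (𝓡 d) q →L[ℝ] ℝ) q₀ q q₀ q B v w =
    B ((trivializationAt (Model d) (TangentSpace (𝓡 d)) q₀).symmL ℝ q v)
      ((trivializationAt (Model d) (TangentSpace (𝓡 d)) q₀).symmL ℝ q w) := by
  have := inCoordinates_apply_eq₂ (F₁ := Model d) (F₂ := Model d) (F₃ := ℝ)
    (E₁ := (TangentSpace (𝓡 d) : M → Type _)) (E₂ := (TangentSpace (𝓡 d) : M → Type _))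
    (E₃ := Bundle.Trivial M ℝ) (ϕ := B) (v := v) (w := w) hq hq (x₀ := q₀) (mem_univ _)
  rw [Trivialization.symmL_apply _ hq, Trivialization.symmL_apply _ hq]
  exact this.trans (LinearMap.congr_fun (Trivial.linearMapAt_trivialization ℝ M ℝ q) _)

theorem covector_inCoordinates_apply {q₀ q : M}
    (hq : q ∈ (trivializationAt (Model d) (TangentSpace (𝓡 d)) q₀).baseSet)
    (p : CotangentSpace d q) (v : Model d) :
    ContinuousLinearMap.inCoordinates (Model d) (TangentSpace (𝓡 d) : M → Type _)
      ℝ (fun _ : M => ℝ) q₀ q q₀ q p v =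
    p ((trivializationAt (Model d) (TangentSpace (𝓡 d)) q₀).symmL ℝ q v) := by
  have := ContinuousLinearMap.inCoordinates_eq (F := Model d) (F' := ℝ)
    (E := (TangentSpace (𝓡 d) : M → Type _)) (E' := Bundle.Trivial M ℝ) (ϕ := p)
    (x₀ := q₀) (y₀ := q₀) (y := q) hq (mem_univ _)
  rw [Trivialization.symmL_apply _ hq]
  exact congrArg (fun T : Model d →L[ℝ] ℝ => T v) this

/-- The pullback of the Euclidean inner product by a linear map. -/
def pullbackInner (A : Model d →L[ℝ] Model d) : Model d →L[ℝ] Model d →L[ℝ] ℝ :=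
  ((innerSL ℝ).comp A).flip.comp A

/-- The Euclidean metric of the trivialization of the tangent bundle at `q₀`. -/
def localMetric (q₀ q : M) : TangentSpace (𝓡 d) q →L[ℝ] TangentSpace (𝓡 d) q →L[ℝ] ℝ :=
  pullbackInner ((trivializationAt (Model d) (TangentSpace (𝓡 d)) q₀).continuousLinearMapAt ℝ q)

theorem localMetric_apply (q₀ q : M) (v w : TangentSpace (𝓡 d) q) :
    localMetric q₀ q v w = inner ℝ
      ((trivializationAt (Model d) (TangentSpace (𝓡 d)) q₀).continuousLinearMapAt ℝ q w)
      ((trivializationAt (Model d) (TangentSpace (𝓡 d)) q₀).continuousLinearMapAt ℝ q v) := rfl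

-- Positive definite symmetric forms are a convex condition in each fibre, so local metrics glue by
-- a partition of unity. The local metric of a trivialization is constant in its coordinates, hence
-- smooth.
set_option synthInstance.maxHeartbeats 200000 in
theorem nonempty_smoothMetric [T2Space M] [CompactSpace M] : Nonempty (SmoothMetric d M) := by
  obtain ⟨s, hs⟩ := exists_contMDiffSection_forall_mem_convex_of_local (𝓡 d) (n := ⊤)
    (F_fiber := Model d →L[ℝ] Model d →L[ℝ] ℝ)
    (fun q : M => TangentSpace (𝓡 d) q →L[ℝ] TangentSpace (𝓡 d) q →L[ℝ] ℝ)
    (fun q => {B | (∀ v w, B v w = B w v) ∧ ∀ v, v ≠ 0 → 0 < B v v})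
    (fun q => by
      rintro B ⟨hB, hB'⟩ B₂ ⟨hB₂, hB₂'⟩ a b ha hb hab
      refine ⟨fun v w => ?_, fun v hv => ?_⟩
      · simp [hB v w, hB₂ v w]
      · have h1 := hB' v hv
        have h2 := hB₂' v hv
        simp only [add_apply, smul_apply, smul_eq_mul]
        rcases ha.eq_or_lt with rfl | ha
        · have : b = 1 := by linarith
          simpa [this] using h2
        · exact add_pos_of_pos_of_nonneg (mul_pos ha h1) (mul_nonneg hb h2.le))
    (fun q₀ => by
      let e := trivializationAt (Model d) (TangentSpace (𝓡 d)) q₀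
      refine ⟨e.baseSet, e.open_baseSet.mem_nhds (mem_baseSet_trivializationAt _ _ q₀),
        localMetric q₀, ?_, fun q hq => ⟨fun v w => ?_, fun v hv => ?_⟩⟩
      · have hsub : e.baseSet ⊆ (trivializationAt (Model d →L[ℝ] Model d →L[ℝ] ℝ)
            (fun q : M => TangentSpace (𝓡 d) q →L[ℝ] TangentSpace (𝓡 d) q →L[ℝ] ℝ) q₀).baseSet :=
          fun q hq => ⟨hq, hq, mem_univ q⟩
        refine (Trivialization.contMDiffOn_section_iff
          (trivializationAt (Model d →L[ℝ] Model d →L[ℝ] ℝ)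
            (fun q : M => TangentSpace (𝓡 d) q →L[ℝ] TangentSpace (𝓡 d) q →L[ℝ] ℝ) q₀)
          e.open_baseSet hsub).2 ?_
        refine (contMDiffOn_const (c := pullbackInner (.id ℝ (Model d)))).congr fun q hq => ?_
        ext v w
        refine (bilin_inCoordinates_apply hq _ v w).trans ?_
        have h1 : ∀ v, e.continuousLinearMapAt ℝ q (e.symmL ℝ q v) = v := fun v =>
          e.continuousLinearMapAt_symmL (R := ℝ) hq v
        rw [localMetric_apply, h1, h1]
        rfl
      · rw [localMetric_apply, localMetric_apply, real_inner_comm]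
      · rw [localMetric_apply, real_inner_self_pos]
        intro h
        have h1 := e.symmL_continuousLinearMapAt (R := ℝ) hq v
        rw [h, map_zero] at h1
        exact hv h1.symm)
  exact ⟨{
    inner := s
    symm := fun q => (hs q).1
    pos := fun q => (hs q).2
    isVonNBounded := fun q => isVonNBounded_of_pos (V := Model d) (s q) (hs q).2
    contMDiff := s.contMDiff }⟩

theorem bilin_inCoordinates_pos (g : SmoothMetric d M) {q₀ q : M}
    (hq : q ∈ (trivializationAt (Model d) (TangentSpace (𝓡 d)) q₀).baseSet) (v : Model d)
    (hv : v ≠ 0) :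
    0 < ContinuousLinearMap.inCoordinates (Model d) (TangentSpace (𝓡 d) : M → Type _)
      (Model d →L[ℝ] ℝ) (fun q : M => TangentSpace (𝓡 d) q →L[ℝ] ℝ) q₀ q q₀ q (g.inner q) v v := by
  rw [bilin_inCoordinates_apply hq]
  refine g.pos q _ fun h => hv ?_
  have h1 := (trivializationAt (Model d) (TangentSpace (𝓡 d)) q₀).continuousLinearMapAt_symmL
    (R := ℝ) hq v
  have h2 : (trivializationAt (Model d) (TangentSpace (𝓡 d)) q₀).symmL ℝ q v = 0 := h
  rw [h2, map_zero] at h1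
  exact h1.symm

/-- The coordinate formula `p · G⁻¹ p` in a fixed trivialization. It makes `conormSq` smooth, since
inversion is smooth at an invertible operator. -/
theorem conormSq_eq (g : SmoothMetric d M) {q₀ q : M}
    (hq : q ∈ (trivializationAt (Model d) (TangentSpace (𝓡 d)) q₀).baseSet)
    (p : CotangentSpace d q) :
    conormSq g q p = ContinuousLinearMap.inCoordinates (Model d) (TangentSpace (𝓡 d) : M → Type _)
      ℝ (fun _ : M => ℝ) q₀ q q₀ q p (ContinuousLinearMap.inverse
        (ContinuousLinearMap.inCoordinates (Model d) (TangentSpace (𝓡 d) : M → Type _)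
          (Model d →L[ℝ] ℝ) (fun q : M => TangentSpace (𝓡 d) q →L[ℝ] ℝ) q₀ q q₀ q (g.inner q))
        (ContinuousLinearMap.inCoordinates (Model d) (TangentSpace (𝓡 d) : M → Type _)
          ℝ (fun _ : M => ℝ) q₀ q q₀ q p)) := by
  set e := trivializationAt (Model d) (TangentSpace (𝓡 d)) q₀
  have hs : e.symmL ℝ q (e.continuousLinearMapAt ℝ q (sharp g q p)) = sharp g q p :=
    e.symmL_continuousLinearMapAt (R := ℝ) hq _
  rw [inverse_eq_of_pos _ (bilin_inCoordinates_pos g hq)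
    (v := e.continuousLinearMapAt ℝ q (sharp g q p)), covector_inCoordinates_apply hq, hs]
  · rfl
  · ext w
    rw [bilin_inCoordinates_apply hq, covector_inCoordinates_apply hq, hs, inner_sharp]

theorem contMDiff_conormSq (g : SmoothMetric d M) :
    ContMDiff (cotangentModel d) 𝓘(ℝ, ℝ) ∞
      fun x : CotangentBundle d M => conormSq g x.proj x.snd := by
  intro x₀
  have h1 : ContMDiffAt (cotangentModel d) 𝓘(ℝ, CoModel d) ∞
      (fun x : CotangentBundle d M => ContinuousLinearMap.inCoordinates (Model d)
        (TangentSpace (𝓡 d) : M → Type _) ℝ (fun _ : M => ℝ) x₀.proj x.proj x₀.proj x.proj x.snd)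
      x₀ :=
    ((contMDiffAt_hom_bundle (fun x : CotangentBundle d M => x)).1 contMDiffAt_id).2
  have h2 : ContMDiffAt (𝓡 d) 𝓘(ℝ, Model d →L[ℝ] Model d →L[ℝ] ℝ) ∞
      (fun q : M => ContinuousLinearMap.inCoordinates (Model d) (TangentSpace (𝓡 d) : M → Type _)
          (Model d →L[ℝ] ℝ) (fun q : M => TangentSpace (𝓡 d) q →L[ℝ] ℝ) x₀.proj q x₀.proj q
          (g.inner q)) x₀.proj :=
    ((contMDiffAt_hom_bundle _).1 g.contMDiff.contMDiffAt).2
  have hmem : x₀.proj ∈ (trivializationAt (Model d) (TangentSpace (𝓡 d)) x₀.proj).baseSet :=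
    mem_baseSet_trivializationAt _ _ _
  have hproj : ContMDiffAt (cotangentModel d) (𝓡 d) ∞
      (fun x : CotangentBundle d M => x.proj) x₀ := Bundle.contMDiffAt_proj _
  have h3 := (isInvertible_of_pos _ (bilin_inCoordinates_pos g hmem)).contDiffAt_map_inverse
    (n := ∞) |>.contMDiffAt
  have h4 := (h3.comp x₀.proj h2).comp x₀ hproj
  refine (h1.clm_apply (h4.clm_apply h1)).congr_of_eventuallyEq ?_
  have hev : ∀ᶠ x : CotangentBundle d M in 𝓝 x₀, x.proj ∈
      (trivializationAt (Model d) (TangentSpace (𝓡 d)) x₀.proj).baseSet :=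
    hproj.continuousAt.eventually ((Trivialization.open_baseSet _).mem_nhds hmem)
  filter_upwards [hev] with x hx
  exact conormSq_eq g hx x.snd

end Metric

/-! ### Derivatives read in preferred charts -/

section Coordinates

variable {E H N : Type*} [NormedAddCommGroup E] [NormedSpace ℝ E] [TopologicalSpace H]
  {I : ModelWithCorners ℝ E H} [I.Boundaryless] [TopologicalSpace N] [ChartedSpace H N]

theorem hasFDerivAt_extChartAt_symm {f : N → ℝ} {x : N} {L : E →L[ℝ] ℝ}
    (hf : HasMFDerivAt I 𝓘(ℝ, ℝ) f x L) :
    HasFDerivAt (f ∘ (extChartAt I x).symm) L (extChartAt I x x) := by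
  have := hf.2
  simp only [writtenInExtChartAt, extChartAt_model_space_eq_id, ModelWithCorners.range_eq_univ,
    PartialEquiv.refl_coe, Function.id_comp] at this
  exact hasFDerivWithinAt_univ.1 this

theorem contDiffAt_extChartAt_symm {f : N → ℝ} {x : N} {n : ℕ∞}
    (hf : ContMDiffAt I 𝓘(ℝ, ℝ) n f x) :
    ContDiffAt ℝ n (f ∘ (extChartAt I x).symm) (extChartAt I x x) := by
  have := (contMDiffAt_iff.1 hf).2
  simp only [extChartAt_model_space_eq_id, ModelWithCorners.range_eq_univ,
    PartialEquiv.refl_coe, Function.id_comp] at this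
  exact contDiffWithinAt_univ.1 this

end Coordinates

/-! ### The cotangent chart and the Hamiltonian vector field -/

section Hamiltonian

variable {d : ℕ} {M : Type*} [TopologicalSpace M] [ChartedSpace (Model d) M]
  [IsManifold (𝓡 d) ∞ M]

theorem symmL_trivializationAt_self (q : M) (v : Model d) :
    (trivializationAt (Model d) (TangentSpace (𝓡 d)) q).symmL ℝ q v = v := by
  rw [TangentBundle.symmL_trivializationAt_eq_core (mem_chart_source _ _)]
  exact (tangentBundleCore (𝓡 d) M).coordChange_self _ _ (mem_chart_source _ _) v

theorem extChartAt_cotangent (x y : CotangentBundle d M) :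
    extChartAt (cotangentModel d) x y = (extChartAt (𝓡 d) x.proj y.proj,
      ContinuousLinearMap.inCoordinates (Model d) (TangentSpace (𝓡 d) : M → Type _)
        ℝ (fun _ : M => ℝ) x.proj y.proj x.proj y.proj y.snd) := by
  have := hom_chart (HB := Model d) (𝕜 := ℝ) (E₂ := fun _ : M => ℝ) (F₂ := ℝ) (F₁ := Model d)
    (E₁ := fun q : M => TangentSpace (𝓡 d) q) x y
  rw [extChartAt_coe, Function.comp_apply, this]
  rfl

/-- A trivialization is the identity over its own centre, so the preferred chart leaves covectors
over the base point unchanged. -/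
theorem extChartAt_cotangent_fiber (x : CotangentBundle d M) (P : CotangentSpace d x.proj) :
    extChartAt (cotangentModel d) x ⟨x.proj, P⟩ = (extChartAt (𝓡 d) x.proj x.proj, P) := by
  rw [extChartAt_cotangent]
  refine Prod.ext rfl ?_
  ext v
  refine (covector_inCoordinates_apply (mem_baseSet_trivializationAt _ _ _) P v).trans ?_
  exact congrArg P (symmL_trivializationAt_self x.proj v)

theorem extChartAt_cotangent_symm_proj (x : CotangentBundle d M) {y : Model d × CoModel d}
    (hy : y ∈ (extChartAt (cotangentModel d) x).target) :
    ((extChartAt (cotangentModel d) x).symm y).proj = (extChartAt (𝓡 d) x.proj).symm y.1 := by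
  rw [FiberBundle.extChartAt_target] at hy
  rw [FiberBundle.extChartAt, PartialEquiv.coe_trans_symm, Function.comp_apply]
  exact Trivialization.proj_symm_apply _ (by
    rw [Trivialization.mem_target]
    exact hy.1.2)

theorem hasMFDerivAt_proj (x : CotangentBundle d M) :
    HasMFDerivAt (cotangentModel d) (𝓡 d) (fun x : CotangentBundle d M => x.proj) x
      (ContinuousLinearMap.fst ℝ (Model d) (CoModel d)) := by
  refine ⟨(Bundle.contMDiffAt_proj (IB := 𝓡 d) (n := ∞) _).continuousAt, ?_⟩
  refine HasFDerivAt.hasFDerivWithinAt ?_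
  refine (hasFDerivAt_fst (𝕜 := ℝ) (p := extChartAt (cotangentModel d) x x)).congr_of_eventuallyEq ?_
  filter_upwards [extChartAt_target_mem_nhds (I := cotangentModel d) x] with y hy
  rw [writtenInExtChartAt, Function.comp_apply, Function.comp_apply,
    extChartAt_cotangent_symm_proj x hy]
  refine (extChartAt (𝓡 d) x.proj).right_inv ?_
  rw [FiberBundle.extChartAt_target] at hy
  exact hy.1.1

theorem extChartAt_cotangent_symm_fiber (x : CotangentBundle d M) (P : CotangentSpace d x.proj) :
    (extChartAt (cotangentModel d) x).symm (extChartAt (𝓡 d) x.proj x.proj, P) = ⟨x.proj, P⟩ := by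
  refine (congrArg _ (extChartAt_cotangent_fiber x P).symm).trans
    ((extChartAt (cotangentModel d) x).left_inv ?_)
  simp only [mfld_simps]
  rw [FiberBundle.chartedSpace_chartAt]
  simp only [mfld_simps]
  exact ⟨mem_baseSet_trivializationAt _ _ _, mem_chart_source _ _⟩

/-- The partial derivative in `p` is a derivative along a line in the fibre, where the chart is the
identity; no coordinate expression of `H` is needed. -/
theorem hasDerivAt_fiber {H : CotangentBundle d M → ℝ} {x : CotangentBundle d M}
    {L : Model d × CoModel d →L[ℝ] ℝ} (hH : HasMFDerivAt (cotangentModel d) 𝓘(ℝ, ℝ) H x L)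
    (ξ : CoModel d) :
    HasDerivAt (fun t : ℝ => H ⟨x.proj, x.snd + t • (show CotangentSpace d x.proj from ξ)⟩)
      (L (0, ξ)) 0 := by
  have h1 := hasFDerivAt_extChartAt_symm hH
  have hx : extChartAt (cotangentModel d) x x =
      ((extChartAt (𝓡 d) x.proj x.proj, (show CoModel d from x.snd)) : Model d × CoModel d) :=
    extChartAt_cotangent_fiber x x.snd
  rw [hx] at h1
  have h2 : HasDerivAt (fun t : ℝ => ((extChartAt (𝓡 d) x.proj x.proj,
      (show CoModel d from x.snd) + t • ξ) : Model d × CoModel d)) (0, ξ) 0 := by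
    refine (hasDerivAt_const _ _).prodMk ?_
    simpa using ((hasDerivAt_id (0 : ℝ)).smul_const ξ).const_add (show CoModel d from x.snd)
  have h0 : (show CoModel d from x.snd) = (show CoModel d from x.snd) + (0 : ℝ) • ξ := by
    rw [zero_smul]
    exact (add_zero _).symm
  rw [h0] at h1
  have h3 := HasFDerivAt.comp_hasDerivAt (x := (0 : ℝ)) (f := fun t : ℝ =>
    ((extChartAt (𝓡 d) x.proj x.proj,
      (show CoModel d from x.snd) + t • ξ) : Model d × CoModel d)) h1 h2
  refine h3.congr_of_eventuallyEq (Eventually.of_forall fun t => ?_)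
  exact congrArg H (extChartAt_cotangent_symm_fiber x _).symm

theorem conormSq_add_smul (g : SmoothMetric d M) (q : M) (p ξ : CotangentSpace d q) (t : ℝ) :
    conormSq g q (p + t • ξ) =
      conormSq g q p + t * (2 * ξ (sharp g q p)) + t ^ 2 * conormSq g q ξ := by
  have hadd : sharp g q (p + t • ξ) = sharp g q p + t • sharp g q ξ := by
    simp only [sharp, map_add, map_smul]
  have hsymm : p (sharp g q ξ) = ξ (sharp g q p) := by
    conv_lhs => rw [← inner_sharp g q p]
    conv_rhs => rw [← inner_sharp g q ξ]
    exact g.symm _ _ _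
  simp only [conormSq]
  rw [hadd]
  simp only [map_add, map_smul, _root_.add_apply, _root_.smul_apply, smul_eq_mul]
  rw [hsymm]
  ring

theorem conormSq_eq_inner (g : SmoothMetric d M) (q : M) (p : CotangentSpace d q) :
    conormSq g q p = g.inner q (sharp g q p) (sharp g q p) := by
  rw [inner_sharp, conormSq]

theorem conormSq_nonneg (g : SmoothMetric d M) (q : M) (p : CotangentSpace d q) :
    0 ≤ conormSq g q p := by
  rw [conormSq_eq_inner]
  rcases eq_or_ne (sharp g q p) 0 with h | h
  · rw [h, map_zero]
  · exact (g.pos q _ h).le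

theorem conormSq_eq_zero (g : SmoothMetric d M) (q : M) {p : CotangentSpace d q}
    (hp : conormSq g q p = 0) : p = 0 := by
  rw [conormSq_eq_inner] at hp
  by_contra hne
  refine (g.pos q (sharp g q p) fun h => hne ?_).ne' hp
  rw [← inner_sharp g q p, h, map_zero]

theorem contMDiff_mechanicalHamiltonian (g : SmoothMetric d M) {f : M → ℝ} {n : ℕ∞}
    (hf : ContMDiff (𝓡 d) 𝓘(ℝ, ℝ) n f) :
    ContMDiff (cotangentModel d) 𝓘(ℝ, ℝ) n (mechanicalHamiltonian g f) := by
  have h1 : ContMDiff (cotangentModel d) (𝓡 d) n (fun x : CotangentBundle d M => x.proj) :=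
    Bundle.contMDiff_proj _
  have h2 : ContMDiff (cotangentModel d) 𝓘(ℝ, ℝ) n
    fun x : CotangentBundle d M => conormSq g x.proj x.snd :=
    (contMDiff_conormSq g).of_le (by exact_mod_cast le_top)
  have h3 := (hf.comp h1).add (h2.smul (contMDiff_const (c := (2 : ℝ)⁻¹)))
  refine h3.congr fun x => ?_
  simp [mechanicalHamiltonian, div_eq_mul_inv]

theorem mfderiv_mechanicalHamiltonian_fiber (g : SmoothMetric d M) {f : M → ℝ}
    (hf : ContMDiff (𝓡 d) 𝓘(ℝ, ℝ) 1 f) (x : CotangentBundle d M) (ξ : CoModel d) :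
    (show Model d × CoModel d →L[ℝ] ℝ from
      mfderiv (cotangentModel d) 𝓘(ℝ, ℝ) (mechanicalHamiltonian g f) x) (0, ξ) =
      ξ (sharp g x.proj x.snd) := by
  have hH := (((contMDiff_mechanicalHamiltonian g (n := 1) hf).mdifferentiable one_ne_zero)
    x).hasMFDerivAt
  refine (hasDerivAt_fiber hH ξ).unique ?_
  have h2 : HasDerivAt (fun t : ℝ => f x.proj + (conormSq g x.proj x.snd +
      t * (2 * ξ (sharp g x.proj x.snd)) + t ^ 2 * conormSq g x.proj ξ) / 2)
      ((2 * ξ (sharp g x.proj x.snd)) / 2) 0 := by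
    have ha := ((hasDerivAt_id (0 : ℝ)).mul_const (2 * ξ (sharp g x.proj x.snd)))
    have hb := (hasDerivAt_pow 2 (0 : ℝ)).mul_const (conormSq g x.proj ξ)
    have := (((ha.const_add (conormSq g x.proj x.snd)).add hb).div_const 2).const_add (f x.proj)
    simpa using this
  rw [mul_div_cancel_left₀ _ two_ne_zero] at h2
  refine h2.congr_of_eventuallyEq (Eventually.of_forall fun t => ?_)
  exact congrArg (fun r => f x.proj + r / 2) (conormSq_add_smul g x.proj x.snd ξ t)

/-- The first Hamilton equation, from the expansion of `|p + tξ|²` to first order in `t`. -/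
theorem hamiltonianVectorField_fst (g : SmoothMetric d M) {f : M → ℝ}
    (hf : ContMDiff (𝓡 d) 𝓘(ℝ, ℝ) 1 f) (x : CotangentBundle d M) :
    (show Model d × CoModel d from hamiltonianVectorField (mechanicalHamiltonian g f) x).1 =
      sharp g x.proj x.snd := by
  ext i
  exact mfderiv_mechanicalHamiltonian_fiber g hf x (EuclideanSpace.proj i)

/-- `dH(X_H) = 0`. -/
theorem mfderiv_hamiltonianVectorField (H : CotangentBundle d M → ℝ) (x : CotangentBundle d M) :
    mfderiv (cotangentModel d) 𝓘(ℝ, ℝ) H x (hamiltonianVectorField H x) = (0 : ℝ) := by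
  set L : Model d × CoModel d →L[ℝ] ℝ := mfderiv (cotangentModel d) 𝓘(ℝ, ℝ) H x with hL
  set a : Model d := WithLp.toLp 2 fun i : Fin d => L (0, EuclideanSpace.proj i) with ha
  set b : CoModel d := L.comp (ContinuousLinearMap.inl ℝ (Model d) (CoModel d)) with hb
  change L (a, -b) = 0
  have h1 : (a, -b) = ((a, 0) : Model d × CoModel d) - (0, b) := by simp
  -- Expanding in coordinates turns both halves of `dH(X_H)` into the sum of `∂H/∂q_i * ∂H/∂p_i`,
  -- with opposite signs.
  have h2 : b = ∑ i, b (EuclideanSpace.single i 1) •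
      (EuclideanSpace.proj i : Model d →L[ℝ] ℝ) := by
    ext v
    conv_lhs => rw [← (EuclideanSpace.basisFun (Fin d) ℝ).sum_repr v]
    simp [mul_comm]
  have h3 : L (0, b) = ∑ i, b (EuclideanSpace.single i 1) * L (0, EuclideanSpace.proj i) := by
    have : ((0, b) : Model d × CoModel d) =
        ContinuousLinearMap.inr ℝ (Model d) (CoModel d) b := rfl
    rw [this, h2, map_sum, map_sum]
    refine Finset.sum_congr rfl fun i _ => ?_
    rw [map_smul, map_smul, smul_eq_mul, ← h2]
    rfl
  have h4 : L (a, 0) = ∑ i, b (EuclideanSpace.single i 1) * L (0, EuclideanSpace.proj i) := by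
    have : L (a, 0) = b a := rfl
    rw [this, h2]
    simp [ha]
  rw [h1, map_sub, h3, h4, sub_self]

/-- Both summands of the Hamiltonian are critical at `(q, 0)`: the conorm has a minimum there and
`f` is critical at `q`. -/
theorem hamiltonianVectorField_eq_zero (g : SmoothMetric d M) {f : M → ℝ}
    (hf : ContMDiff (𝓡 d) 𝓘(ℝ, ℝ) 1 f) {q : M} (hq : mfderiv (𝓡 d) 𝓘(ℝ, ℝ) f q = 0) :
    hamiltonianVectorField (mechanicalHamiltonian g f) (⟨q, 0⟩ : CotangentBundle d M) = 0 := by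
  set x : CotangentBundle d M := ⟨q, 0⟩
  have hK : HasMFDerivAt (cotangentModel d) 𝓘(ℝ, ℝ)
      (fun x : CotangentBundle d M => conormSq g x.proj x.snd) x
      (0 : Model d × CoModel d →L[ℝ] ℝ) := by
    have hK := ((contMDiff_conormSq g).mdifferentiable (by simp) x).hasMFDerivAt
    have hmin : IsLocalMin ((fun x : CotangentBundle d M => conormSq g x.proj x.snd) ∘
        (extChartAt (cotangentModel d) x).symm) (extChartAt (cotangentModel d) x x) := by
      refine Eventually.of_forall fun y => ?_
      have h0 : conormSq g x.proj x.snd = 0 := rfl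
      rw [Function.comp_apply, Function.comp_apply, extChartAt_to_inv, h0]
      exact conormSq_nonneg g _ _
    exact hmin.hasFDerivAt_eq_zero (hasFDerivAt_extChartAt_symm hK) ▸ hK
  have hf1 : HasMFDerivAt (𝓡 d) 𝓘(ℝ, ℝ) f q (0 : Model d →L[ℝ] ℝ) := by
    have := (hf.mdifferentiable one_ne_zero q).hasMFDerivAt
    rwa [hq] at this
  have hf2 : HasMFDerivAt (cotangentModel d) 𝓘(ℝ, ℝ) (fun x : CotangentBundle d M => f x.proj) x
      (0 : Model d × CoModel d →L[ℝ] ℝ) :=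
    HasMFDerivAt.comp x hf1 (hasMFDerivAt_proj x)
  have hH : HasMFDerivAt (cotangentModel d) 𝓘(ℝ, ℝ) (mechanicalHamiltonian g f) x
      (0 : Model d × CoModel d →L[ℝ] ℝ) := by
    refine ⟨(contMDiff_mechanicalHamiltonian g (n := 1) hf).continuous.continuousAt, ?_⟩
    have := (hasFDerivAt_extChartAt_symm hf2).add
      ((hasFDerivAt_extChartAt_symm hK).mul_const (2 : ℝ)⁻¹)
    rw [smul_zero, add_zero] at this
    exact this.hasFDerivWithinAt
  have h0 := hH.mfderiv
  unfold hamiltonianVectorField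
  rw [h0]
  refine Prod.ext ?_ ?_
  · ext i
    rfl
  · exact neg_eq_zero.2 (ContinuousLinearMap.zero_comp _)

end Hamiltonian

/-! ### Second-order bound at a critical point and local Grönwall -/

section Calculus

/-- The derivative is Lipschitz near `x` and vanishes at `x`, so it is at most `K * ‖y - x‖` on the
ball of radius `‖y - x‖`; the mean value inequality on that ball adds the second factor. -/
theorem eventually_abs_sub_le_sq {E : Type*} [NormedAddCommGroup E] [NormedSpace ℝ E]
    {F : E → ℝ} {x : E} (hF : ContDiffAt ℝ 2 F x) (hx : fderiv ℝ F x = 0) :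
    ∃ C : ℝ, 0 ≤ C ∧ ∀ᶠ y in 𝓝 x, |F y - F x| ≤ C * ‖y - x‖ ^ 2 := by
  have h1 : ContDiffAt ℝ 1 (fderiv ℝ F) x := hF.fderiv_right (by norm_num)
  obtain ⟨K, t, ht, hK⟩ := h1.exists_lipschitzOnWith
  have hdiff : ∀ᶠ y in 𝓝 x, DifferentiableAt ℝ F y :=
    (hF.eventually (by simp)).mono fun y hy => hy.differentiableAt (by simp)
  obtain ⟨r, hr, hball⟩ := Metric.mem_nhds_iff.1 (inter_mem ht hdiff)
  refine ⟨K, K.coe_nonneg, ?_⟩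
  filter_upwards [Metric.ball_mem_nhds x hr] with y hy
  have hsub : Metric.closedBall x ‖y - x‖ ⊆ Metric.ball x r :=
    Metric.closedBall_subset_ball (by rwa [← dist_eq_norm])
  have h2 := (convex_closedBall x ‖y - x‖).norm_image_sub_le_of_norm_fderiv_le (𝕜 := ℝ)
    (f := F) (C := K * ‖y - x‖) (fun z hz => (hball (hsub hz)).2) (fun z hz => by
      have h3 := hK.dist_le_mul z (hball (hsub hz)).1 x (mem_of_mem_nhds ht)
      rw [hx, dist_zero_right] at h3
      exact h3.trans (mul_le_mul_of_nonneg_left (Metric.mem_closedBall.1 hz) K.coe_nonneg))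
    (Metric.mem_closedBall_self (norm_nonneg _))
    (show y ∈ Metric.closedBall x ‖y - x‖ by rw [Metric.mem_closedBall, dist_eq_norm])
  rw [Real.norm_eq_abs] at h2
  calc _ ≤ _ := h2
    _ = _ := by ring

/-- Grönwall's inequality forward in time, and backward after the reversal `t ↦ -t`. -/
theorem eventually_eq_zero_of_norm_deriv_le {E : Type*} [NormedAddCommGroup E] [NormedSpace ℝ E]
    {u u' : ℝ → E} {t₀ K : ℝ} (h0 : u t₀ = 0)
    (h : ∀ᶠ t in 𝓝 t₀, HasDerivAt u (u' t) t ∧ ‖u' t‖ ≤ K * ‖u t‖) : ∀ᶠ t in 𝓝 t₀, u t = 0 := by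
  obtain ⟨r, hr, hball⟩ := Metric.mem_nhds_iff.1 h
  rw [Real.ball_eq_Ioo] at hball
  have hright : ∀ t ∈ Icc t₀ (t₀ + r / 2), u t = 0 := by
    refine eq_zero_of_abs_deriv_le_mul_abs_self_of_eq_zero_right (K := K) (f' := u')
      (fun t ht => (hball ⟨by linarith [ht.1], by linarith [ht.2]⟩).1.continuousAt.continuousWithinAt)
      (fun t ht => (hball ⟨by linarith [ht.1], by linarith [ht.2]⟩).1.hasDerivWithinAt) h0
      (fun t ht => (hball ⟨by linarith [ht.1], by linarith [ht.2]⟩).2)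
  have hneg : ∀ t ∈ Icc (-t₀) (-t₀ + r / 2), HasDerivAt (fun t => u (-t)) (-u' (-t)) t := by
    intro t ht
    have := (hball (show -t ∈ Ioo (t₀ - r) (t₀ + r) from
      ⟨by linarith [ht.2], by linarith [ht.1]⟩)).1.scomp t (hasDerivAt_neg t)
    rw [neg_one_smul] at this
    exact this
  have hleft : ∀ t ∈ Icc (-t₀) (-t₀ + r / 2), u (-t) = 0 := by
    refine eq_zero_of_abs_deriv_le_mul_abs_self_of_eq_zero_right (K := K) (f := fun t => u (-t))
      (f' := fun t => -u' (-t)) (fun t ht => (hneg t ht).continuousAt.continuousWithinAt)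
      (fun t ht => (hneg t (Ico_subset_Icc_self ht)).hasDerivWithinAt) (by simpa using h0)
      (fun t ht => ?_)
    rw [norm_neg]
    exact (hball ⟨by linarith [ht.2], by linarith [ht.1]⟩).2
  filter_upwards [Ioo_mem_nhds (show t₀ - r / 2 < t₀ by linarith)
    (show t₀ < t₀ + r / 2 by linarith)] with t ht
  rcases le_total t₀ t with h | h
  · exact hright t ⟨h, ht.2.le⟩
  · simpa using hleft (-t) ⟨by linarith, by linarith [ht.1]⟩

end Calculus

/-! ### Energy conservation, rest points and invariance -/

section Dynamics

variable {d : ℕ} {M : Type*} [TopologicalSpace M] [ChartedSpace (Model d) M]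
  [IsManifold (𝓡 d) ∞ M]

/-- The differential of the chart is the tangent trivialization, whose norm relative to the
continuous metric `g` is locally bounded. -/
theorem eventually_norm_sq_mfderiv_extChartAt_le (g : SmoothMetric d M) (q₀ : M) :
    ∃ C : ℝ, 0 ≤ C ∧ ∀ᶠ q in 𝓝 q₀, ∀ v : TangentSpace (𝓡 d) q,
      ‖(show Model d from mfderiv (𝓡 d) 𝓘(ℝ, Model d) (extChartAt (𝓡 d) q₀) q v)‖ ^ 2 ≤
        C * g.inner q v v := by
  let : RiemannianBundle (fun q : M => TangentSpace (𝓡 d) q) := ⟨g.toRiemannianMetric⟩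
  have : IsContinuousRiemannianBundle (Model d) (fun q : M => TangentSpace (𝓡 d) q) :=
    ⟨⟨g.inner, g.contMDiff.continuous, fun _ _ _ => rfl⟩⟩
  obtain ⟨C, hC, h⟩ := eventually_norm_trivializationAt_lt (Model d)
    (fun q : M => TangentSpace (𝓡 d) q) q₀
  refine ⟨C ^ 2, by positivity, ?_⟩
  filter_upwards [h, (chartAt (Model d) q₀).open_source.mem_nhds (mem_chart_source _ q₀)]
    with q hq hqs v
  rw [← TangentBundle.continuousLinearMapAt_trivializationAt hqs]
  have h1 := ContinuousLinearMap.le_of_opNorm_le _ hq.le v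
  have h2 : g.inner q v v = ‖v‖ ^ 2 := real_inner_self_eq_norm_sq v
  rw [h2, ← mul_pow]
  exact pow_le_pow_left₀ (norm_nonneg _) h1 2

theorem IsMIntegralCurveOn.hamiltonian_eq {H : CotangentBundle d M → ℝ}
    (hH : ContMDiff (cotangentModel d) 𝓘(ℝ, ℝ) 1 H) {γ : ℝ → CotangentBundle d M} {a b : ℝ}
    (hγ : IsMIntegralCurveOn (I := cotangentModel d) γ (hamiltonianVectorField H) (Ioo a b))
    {t t' : ℝ} (ht : t ∈ Ioo a b) (ht' : t' ∈ Ioo a b) : H (γ t) = H (γ t') := by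
  have h : ∀ t ∈ Ioo a b, HasDerivAt (H ∘ γ) 0 t := by
    intro t ht
    have h1 := (hγ t ht).hasMFDerivAt (Ioo_mem_nhds ht.1 ht.2)
    have h2 := (hH.mdifferentiable one_ne_zero (γ t)).hasMFDerivAt
    have h3 : HasFDerivAt (H ∘ γ) ((show Model d × CoModel d →L[ℝ] ℝ from
        mfderiv (cotangentModel d) 𝓘(ℝ, ℝ) H (γ t)).comp ((1 : ℝ →L[ℝ] ℝ).smulRight
        (show Model d × CoModel d from hamiltonianVectorField H (γ t)))) t :=
      hasMFDerivAt_iff_hasFDerivAt.1 (HasMFDerivAt.comp t h2 h1)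
    refine h3.hasDerivAt.congr_deriv (Eq.trans ?_ (mfderiv_hamiltonianVectorField H (γ t)))
    exact congrArg (mfderiv (cotangentModel d) 𝓘(ℝ, ℝ) H (γ t)) (one_smul ℝ _)
  exact isOpen_Ioo.is_const_of_deriv_eq_zero (f := H ∘ γ) isPreconnected_Ioo
    (fun t ht => (h t ht).differentiableAt.differentiableWithinAt)
    (fun t ht => (h t ht).deriv) ht ht'

theorem hasDerivAt_extChartAt_proj (g : SmoothMetric d M) {f : M → ℝ}
    (hf : ContMDiff (𝓡 d) 𝓘(ℝ, ℝ) 1 f) {γ : ℝ → CotangentBundle d M} {a b : ℝ}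
    (hγ : IsMIntegralCurveOn (I := cotangentModel d) γ
      (hamiltonianVectorField (mechanicalHamiltonian g f)) (Ioo a b))
    {t : ℝ} (ht : t ∈ Ioo a b) {q₀ : M} (hq : (γ t).proj ∈ (chartAt (Model d) q₀).source) :
    HasDerivAt (fun t => extChartAt (𝓡 d) q₀ (γ t).proj)
      (show Model d from mfderiv (𝓡 d) 𝓘(ℝ, Model d) (extChartAt (𝓡 d) q₀) (γ t).proj
        (sharp g (γ t).proj (γ t).snd)) t := by
  have h1 := (hγ t ht).hasMFDerivAt (Ioo_mem_nhds ht.1 ht.2)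
  have h2 := HasMFDerivAt.comp t (hasMFDerivAt_proj (γ t)) h1
  have h3 := ((contMDiffAt_extChartAt' (I := 𝓡 d) (n := 1) hq).mdifferentiableAt
    one_ne_zero).hasMFDerivAt
  have h4 : HasFDerivAt (fun t => extChartAt (𝓡 d) q₀ (γ t).proj)
      ((show Model d →L[ℝ] Model d from
        mfderiv (𝓡 d) 𝓘(ℝ, Model d) (extChartAt (𝓡 d) q₀) (γ t).proj).comp
        ((ContinuousLinearMap.fst ℝ (Model d) (CoModel d)).comp ((1 : ℝ →L[ℝ] ℝ).smulRight
          (show Model d × CoModel d from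
            hamiltonianVectorField (mechanicalHamiltonian g f) (γ t))))) t :=
    hasMFDerivAt_iff_hasFDerivAt.1 (HasMFDerivAt.comp t h3 h2)
  refine h4.hasDerivAt.congr_deriv ?_
  refine congrArg (mfderiv (𝓡 d) 𝓘(ℝ, Model d) (extChartAt (𝓡 d) q₀) (γ t).proj) ?_
  exact (congrArg Prod.fst (one_smul ℝ _)).trans (hamiltonianVectorField_fst g hf (γ t))

/-- For a potential of class `C^2`, an orbit that meets a rest point `(q, 0)` over a critical point
`q` of the potential is constant: its energy bounds its speed by the distance to the rest point. -/
theorem containsItsOrbits_mechanicalHamiltonian [T2Space M] (g : SmoothMetric d M) {f : M → ℝ}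
    (hf : ContMDiff (𝓡 d) 𝓘(ℝ, ℝ) 2 f) {Λ₀ : Set M}
    (hΛ : ∀ q ∈ Λ₀, mfderiv (𝓡 d) 𝓘(ℝ, ℝ) f q = 0) :
    ContainsItsOrbits (mechanicalHamiltonian g f)
      {x : CotangentBundle d M | x.proj ∈ Λ₀ ∧ x.snd = 0} := by
  rintro γ a b hγ t₀ ht₀ ⟨hq₀, hp₀⟩
  have hf1 : ContMDiff (𝓡 d) 𝓘(ℝ, ℝ) 1 f := hf.of_le (by norm_num)
  have hcont : ∀ t ∈ Ioo a b, ContinuousAt (fun t => (γ t).proj) t := fun t ht =>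
    (hasMFDerivAt_proj (γ t)).continuousAt.comp
      ((hγ t ht).hasMFDerivAt (Ioo_mem_nhds ht.1 ht.2)).continuousAt
  set q₀ := (γ t₀).proj with hq₀_def
  -- The energy of the orbit equals `f q₀`, because `p = 0` at time `t₀`.
  have henergy : ∀ t ∈ Ioo a b, conormSq g (γ t).proj (γ t).snd = 2 * (f q₀ - f (γ t).proj) := by
    intro t ht
    have h := IsMIntegralCurveOn.hamiltonian_eq (contMDiff_mechanicalHamiltonian g (n := 1) hf1)
      hγ ht ht₀
    have h0 : conormSq g (γ t₀).proj (γ t₀).snd = 0 := by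
      rw [hp₀]
      rfl
    rw [mechanicalHamiltonian, mechanicalHamiltonian, h0] at h
    linarith
  -- Connectedness of the interval: the times spent at `q₀` form an open set by Grönwall and a
  -- relatively closed one by continuity.
  have hsub : Ioo a b ⊆ {t | t ∈ Ioo a b ∧ (γ t).proj = q₀} := by
    refine isPreconnected_Ioo.subset_of_closure_inter_subset ?_ ⟨t₀, ht₀, ht₀, rfl⟩ ?_
    · rw [isOpen_iff_mem_nhds]
      rintro t₁ ⟨ht₁, hqt₁⟩
      obtain ⟨C, hC, hCev⟩ := eventually_norm_sq_mfderiv_extChartAt_le g q₀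
      have hF2 : ContDiffAt ℝ 2 (f ∘ (extChartAt (𝓡 d) q₀).symm) (extChartAt (𝓡 d) q₀ q₀) :=
        contDiffAt_extChartAt_symm (n := 2) (hf q₀)
      have hF' : fderiv ℝ (f ∘ (extChartAt (𝓡 d) q₀).symm) (extChartAt (𝓡 d) q₀ q₀) = 0 := by
        have h := (hf1.mdifferentiable one_ne_zero q₀).hasMFDerivAt
        rw [hΛ q₀ hq₀] at h
        exact (hasFDerivAt_extChartAt_symm h).fderiv
      obtain ⟨C', hC', hFev⟩ := eventually_abs_sub_le_sq hF2 hF'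
      have hqcont := hcont t₁ ht₁
      have hnear : Tendsto (fun t => (γ t).proj) (𝓝 t₁) (𝓝 q₀) := by
        rw [← hqt₁]
        exact hqcont
      have hchart := hnear.eventually
        ((continuousAt_extChartAt (I := 𝓡 d) q₀).eventually hFev)
      have hsource := hnear.eventually
        ((chartAt (Model d) q₀).open_source.mem_nhds (mem_chart_source _ q₀))
      have hI := Ioo_mem_nhds ht₁.1 ht₁.2
      -- Squared chart speed ≤ `C * |p|²` = `2 * C * (f q₀ - f q)` ≤ `2 * C * C'` times the squared
      -- chart distance to `q₀`.
      have hzero := eventually_eq_zero_of_norm_deriv_le (t₀ := t₁) (K := √(2 * C * C'))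
        (u := fun t => extChartAt (𝓡 d) q₀ (γ t).proj - extChartAt (𝓡 d) q₀ q₀)
        (u' := fun t => mfderiv (𝓡 d) 𝓘(ℝ, Model d) (extChartAt (𝓡 d) q₀) (γ t).proj
          (sharp g (γ t).proj (γ t).snd)) (by simp [hqt₁]) (by
          filter_upwards [hI, hchart, hsource, hnear.eventually hCev] with t ht h1 h2 h3
          refine ⟨(hasDerivAt_extChartAt_proj g hf1 hγ ht h2).sub_const _, ?_⟩
          refine abs_le_of_sq_le_sq' ?_ (by positivity) |>.2
          have h4 := h3 (sharp g (γ t).proj (γ t).snd)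
          rw [← conormSq_eq_inner, henergy t ht] at h4
          refine h4.trans ?_
          rw [mul_pow, Real.sq_sqrt (by positivity)]
          rw [Function.comp_apply, Function.comp_apply, extChartAt_to_inv,
            (extChartAt (𝓡 d) q₀).left_inv (by rwa [extChartAt_source]), abs_sub_comm] at h1
          have h5 := (le_abs_self _).trans h1
          nlinarith [mul_le_mul_of_nonneg_left h5 hC])
      filter_upwards [hI, hsource, hzero] with t ht h1 h2
      refine ⟨ht, (extChartAt (𝓡 d) q₀).injOn (by rwa [extChartAt_source])
        (mem_extChartAt_source _) (sub_eq_zero.1 h2)⟩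
    · rintro t ⟨htc, ht⟩
      refine ⟨ht, ?_⟩
      have hfreq : ∃ᶠ t' in 𝓝 t, (γ t').proj = q₀ :=
        (mem_closure_iff_frequently.1 htc).mono fun _ h => h.2
      exact tendsto_nhds_unique_of_frequently_eq (hcont t ht) tendsto_const_nhds hfreq
  intro t ht
  have hqt := (hsub ht).2
  refine ⟨by rw [hqt]; exact hq₀, conormSq_eq_zero g _ ?_⟩
  rw [henergy t ht, hqt, sub_self, mul_zero]

theorem isInvariant_mechanicalHamiltonian (g : SmoothMetric d M) {f : M → ℝ}
    (hf : ContMDiff (𝓡 d) 𝓘(ℝ, ℝ) 1 f) {Λ₀ : Set M}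
    (hΛ : ∀ q ∈ Λ₀, mfderiv (𝓡 d) 𝓘(ℝ, ℝ) f q = 0) :
    IsInvariant (mechanicalHamiltonian g f)
      {x : CotangentBundle d M | x.proj ∈ Λ₀ ∧ x.snd = 0} := by
  rintro ⟨q, p⟩ ⟨hq, hp⟩
  obtain rfl : p = 0 := hp
  refine ⟨fun _ => ⟨q, 0⟩, rfl, ?_, fun _ => ⟨hq, rfl⟩⟩
  exact isMIntegralCurve_const (hamiltonianVectorField_eq_zero g hf (hΛ q hq))

end Dynamics

/-! ### Functions that are locally smooth pullbacks -/

section PullBack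

variable {V E H N : Type*} [NormedAddCommGroup V] [NormedSpace ℝ V] [NormedAddCommGroup E]
  [NormedSpace ℝ E] [TopologicalSpace H] {I : ModelWithCorners ℝ E H} [TopologicalSpace N]
  [ChartedSpace H N]

/-- Near `x` the function `f` is `F ∘ h` for a smooth map `h` with `h x ∈ K`. -/
def IsPullBackAt (I : ModelWithCorners ℝ E H) (F : V → ℝ) (K : Set V) (f : N → ℝ) (x : N) : Prop :=
  ∃ U, IsOpen U ∧ x ∈ U ∧ ∃ h : N → V, ContMDiffOn I 𝓘(ℝ, V) ∞ h U ∧ h x ∈ K ∧ EqOn f (F ∘ h) U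

theorem IsPullBackAt.contMDiffAt {F : V → ℝ} {K : Set V} {f : N → ℝ} {x : N} {n : ℕ∞}
    (h : IsPullBackAt I F K f x) (hF : ContDiff ℝ n F) : ContMDiffAt I 𝓘(ℝ, ℝ) n f x := by
  obtain ⟨U, hU, hx, h, hh, -, hf⟩ := h
  have h1 : ContMDiffAt I 𝓘(ℝ, V) n h x :=
    (hh.contMDiffAt (hU.mem_nhds hx)).of_le (by exact_mod_cast le_top)
  exact ((hF.contMDiff.contMDiffAt (x := h x)).comp x h1).congr_of_eventuallyEq
    (hf.eventuallyEq_of_mem (hU.mem_nhds hx))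

theorem IsPullBackAt.mfderiv_eq_zero {F : V → ℝ} {K : Set V} {f : N → ℝ} {x : N}
    (h : IsPullBackAt I F K f x) (hF : ∀ y ∈ K, HasFDerivAt F (0 : V →L[ℝ] ℝ) y) :
    mfderiv I 𝓘(ℝ, ℝ) f x = 0 := by
  obtain ⟨U, hU, hx, h, hh, hhx, hf⟩ := h
  have h1 := ((hh.contMDiffAt (hU.mem_nhds hx)).mdifferentiableAt (by simp)).hasMFDerivAt
  have h2 := HasMFDerivAt.comp x (hF _ hhx).hasMFDerivAt h1
  rw [(hf.eventuallyEq_of_mem (hU.mem_nhds hx)).mfderiv_eq]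
  exact h2.mfderiv.trans (ContinuousLinearMap.zero_comp _)

/-- In the chart at `x` the function is still `F` composed with a smooth map, so the dyadic bounds
apply whatever the manifold, in particular on `M` and on its cotangent bundle. -/
theorem IsPullBackAt.ckHolderAt [I.Boundaryless] [IsManifold I ∞ N] [FiniteDimensional ℝ E]
    {F : V → ℝ} {K : Set V} {f : N → ℝ} {x : N} {q : ℝ} {m k : ℕ} {s : ℝ≥0}
    (h : IsPullBackAt I F K f x) (hq : 0 ≤ q) (hF : IsDyadicSeries q m F) (hk : k + 1 ≤ m)
    (hs : s ≤ 1) (hkq : 2 ^ k * 2 ^ (s : ℝ) * q < 1) :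
    CkHolderAt k s (f ∘ (extChartAt I x).symm) (extChartAt I x x) := by
  obtain ⟨U, hU, hx, h, hh, -, hf⟩ := h
  have hW : (extChartAt I x).target ∩ (extChartAt I x).symm ⁻¹' U ∈ 𝓝 (extChartAt I x x) :=
    inter_mem (extChartAt_target_mem_nhds x)
      ((continuousAt_extChartAt_symm x).preimage_mem_nhds
        (by rw [extChartAt_to_inv]; exact hU.mem_nhds hx))
  have h1 : ContDiffOn ℝ ∞ (h ∘ (extChartAt I x).symm)
      ((extChartAt I x).target ∩ (extChartAt I x).symm ⁻¹' U) := by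
    rw [← contMDiffOn_iff_contDiffOn]
    exact hh.comp ((contMDiffOn_extChartAt_symm x).mono inter_subset_left) fun y hy => hy.2
  refine (hF.ckHolderAt_comp hq hk hs hkq hW h1).congr ?_
  filter_upwards [hW] with y hy
  exact hf hy.2

end PullBack

/-! ### Copying the Euclidean example to the manifold -/

section Transplant

variable {d : ℕ} {M : Type*} [TopologicalSpace M] [ChartedSpace (Model d) M]
  [IsManifold (𝓡 d) ∞ M]

/-- A compactly supported function on `ℝ^d` can be copied, after a rescaling, to any manifold. -/
theorem exists_isPullBackAt [T2Space M] [Nonempty M] [Nontrivial (Model d)] {F : Model d → ℝ}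
    {K : Set (Model d)} {R : ℝ} (hR : 0 ≤ R) (hF : ∀ x, F x ≠ 0 → ‖x‖ ≤ R) (hK : IsCompact K)
    (hKc : IsConnected K) (hKR : ∀ x ∈ K, ‖x‖ ≤ R) (hne : ∃ x ∈ K, ∃ y ∈ K, F x ≠ F y) :
    ∃ (f : M → ℝ) (Λ₀ : Set M), IsCompact Λ₀ ∧ IsConnected Λ₀ ∧
      (∀ x, IsPullBackAt (𝓡 d) F univ f x) ∧ (∀ x ∈ Λ₀, IsPullBackAt (𝓡 d) F K f x) ∧
      ∃ x ∈ Λ₀, ∃ y ∈ Λ₀, f x ≠ f y := by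
  classical
  obtain ⟨q₀⟩ := ‹Nonempty M›
  set φ := extChartAt (𝓡 d) q₀ with hφ
  set b := φ q₀ with hb
  obtain ⟨r, hr, hball⟩ := Metric.nhds_basis_closedBall.mem_iff.1
    (extChartAt_target_mem_nhds (I := 𝓡 d) q₀)
  -- The dilation by `c⁻¹` brings the ball of radius `R`, which contains `K` and the points where `F
  -- ≠ 0`, into the ball of radius `r` inside the chart target; `R + 1` keeps `c` positive when `R =
  -- 0`.
  set c : ℝ := (R + 1) / r with hc
  have hc0 : 0 < c := by positivity
  have hRc : R / c ≤ r := by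
    rw [hc, div_div_eq_mul_div, div_le_iff₀ (by positivity)]
    nlinarith
  set h : M → Model d := fun q => c • (φ q - b) with hh
  set σ : Model d → Model d := fun x => b + c⁻¹ • x with hσ
  have hσball : ∀ x, ‖x‖ ≤ R → σ x ∈ Metric.closedBall b r := by
    intro x hx
    rw [Metric.mem_closedBall, dist_eq_norm, hσ]
    simp only [add_sub_cancel_left, norm_smul, norm_inv, Real.norm_eq_abs, abs_of_pos hc0]
    calc c⁻¹ * ‖x‖ ≤ c⁻¹ * R := by gcongr
      _ = R / c := by rw [div_eq_inv_mul]
      _ ≤ r := hRc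
  have hhσ : ∀ x, ‖x‖ ≤ R → h (φ.symm (σ x)) = x := by
    intro x hx
    simp only [hh]
    rw [φ.right_inv (hball (hσball x hx)), hσ]
    simp [smul_smul, hc0.ne']
  have hσh : ∀ q, σ (h q) = φ q := by
    intro q
    simp [hσ, hh, smul_smul, hc0.ne']
  set S : Set M := φ.symm '' Metric.closedBall b r with hS
  have hScompact : IsCompact S := (isCompact_closedBall b r).image_of_continuousOn
    ((continuousOn_extChartAt_symm q₀).mono hball)
  have hSsource : S ⊆ φ.source := by
    rintro _ ⟨y, hy, rfl⟩
    exact φ.map_target (hball hy)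
  set f : M → ℝ := fun q => if q ∈ φ.source then F (h q) else 0 with hf
  have hsmooth : ContMDiffOn (𝓡 d) 𝓘(ℝ, Model d) ∞ h φ.source := by
    have h1 : ContMDiffOn (𝓡 d) 𝓘(ℝ, Model d) ∞ φ φ.source := by
      rw [hφ, extChartAt_source]
      exact contMDiffOn_extChartAt
    have h2 : ContDiff ℝ ∞ fun y : Model d => c • (y - b) := by fun_prop
    exact h2.contMDiff.comp_contMDiffOn h1
  have hfeq : EqOn f (F ∘ h) φ.source := fun q hq => if_pos hq
  have hzero : ∀ q ∉ S, f q = 0 := by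
    intro q hq
    by_cases hqs : q ∈ φ.source
    · rw [hfeq hqs]
      by_contra hne
      refine hq ⟨σ (h q), hσball _ (hF _ hne), ?_⟩
      rw [hσh, φ.left_inv hqs]
    · exact if_neg hqs
  have hpull : ∀ x ∈ φ.source, ∀ K' : Set (Model d), h x ∈ K' →
      IsPullBackAt (𝓡 d) F K' f x := fun x hx K' hK' =>
    ⟨φ.source, isOpen_extChartAt_source q₀, hx, h, hsmooth, hK', hfeq⟩
  have hKsource : ∀ x ∈ K, φ.symm (σ x) ∈ φ.source := fun x hx =>
    hSsource ⟨_, hσball x (hKR x hx), rfl⟩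
  have hcont : ContinuousOn (φ.symm ∘ σ) K :=
    (continuousOn_extChartAt_symm q₀).comp (by fun_prop)
      fun x hx => hball (hσball x (hKR x hx))
  refine ⟨f, (φ.symm ∘ σ) '' K, hK.image_of_continuousOn hcont, hKc.image _ hcont, ?_, ?_, ?_⟩
  · intro x
    by_cases hx : x ∈ φ.source
    · exact hpull x hx _ (mem_univ _)
    -- Off the chart domain `f` vanishes nearby, so it is the pullback of `F` by a constant map to a
    -- point `y` outside the support radius. The set `S` is compact, hence closed.
    · obtain ⟨y, hy⟩ := NormedSpace.exists_lt_norm ℝ (Model d) R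
      refine ⟨Sᶜ, hScompact.isClosed.isOpen_compl, fun hxS => hx (hSsource hxS), fun _ => y,
        contMDiffOn_const, mem_univ _, fun q hq => ?_⟩
      rw [hzero q hq, Function.comp_apply]
      by_contra hne
      exact (hF y (Ne.symm hne)).not_gt hy
  · rintro _ ⟨x, hx, rfl⟩
    refine hpull _ (hKsource x hx) _ ?_
    rw [hhσ x (hKR x hx)]
    exact hx
  · obtain ⟨x, hx, y, hy, hxy⟩ := hne
    refine ⟨_, ⟨x, hx, rfl⟩, _, ⟨y, hy, rfl⟩, ?_⟩
    rw [Function.comp_apply, Function.comp_apply, hfeq (hKsource x hx), hfeq (hKsource y hy),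
      Function.comp_apply, Function.comp_apply, hhσ x (hKR x hx), hhσ y (hKR y hy)]
    exact hxy

/-- The potential term is a pullback of `F` through the bundle projection, and the kinetic term is
smooth. -/
theorem isCkHolder_mechanicalHamiltonian (g : SmoothMetric d M) {f : M → ℝ} {F : Model d → ℝ}
    (hf : ∀ x, IsPullBackAt (𝓡 d) F univ f x) {q : ℝ} {m k : ℕ} {s : ℝ≥0} (hq : 0 ≤ q)
    (hF : IsDyadicSeries q m F) (hk : k + 1 ≤ m) (hs : s ≤ 1)
    (hkq : 2 ^ k * 2 ^ (s : ℝ) * q < 1) :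
    IsCkHolder (cotangentModel d) k s (mechanicalHamiltonian g f) := by
  intro x
  have hproj : ContMDiff (cotangentModel d) (𝓡 d) ∞ (fun x : CotangentBundle d M => x.proj) :=
    Bundle.contMDiff_proj _
  have h1 : IsPullBackAt (cotangentModel d) F univ (fun x : CotangentBundle d M => f x.proj) x := by
    obtain ⟨U, hU, hx, h, hh, -, hfh⟩ := hf x.proj
    exact ⟨(fun x : CotangentBundle d M => x.proj) ⁻¹' U, hU.preimage hproj.continuous, hx,
      h ∘ fun x => x.proj, hh.comp hproj.contMDiffOn fun _ hy => hy, mem_univ _, fun y hy => hfh hy⟩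
  have : FiniteDimensional ℝ (Model d × CoModel d) := inferInstance
  have h2 := h1.ckHolderAt hq hF hk hs hkq
  have h3 := (contDiffAt_extChartAt_symm (contMDiff_conormSq g x)).mul
    (contDiffAt_const (c := (2 : ℝ)⁻¹))
  have h4 := ContDiffAt.ckHolderAt (k := k) hs (h3.of_le (by exact_mod_cast le_top))
  refine (h2.add h4).congr (Eventually.of_forall fun y => ?_)
  simp [mechanicalHamiltonian, div_eq_mul_inv]

theorem isCkHolder_of_isPullBackAt {f : M → ℝ} {F : Model d → ℝ}
    (hf : ∀ x, IsPullBackAt (𝓡 d) F univ f x) {q : ℝ} {m k : ℕ} {s : ℝ≥0} (hq : 0 ≤ q)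
    (hF : IsDyadicSeries q m F) (hk : k + 1 ≤ m) (hs : s ≤ 1)
    (hkq : 2 ^ k * 2 ^ (s : ℝ) * q < 1) : IsCkHolder (𝓡 d) k s f :=
  fun x => (hf x).ckHolderAt hq hF hk hs hkq

theorem image_zeroSection (Λ₀ : Set M) :
    {x : CotangentBundle d M | x.proj ∈ Λ₀ ∧ x.snd = 0} =
      zeroSection (CoModel d) (fun q : M => TangentSpace (𝓡 d) q →L[ℝ] ℝ) '' Λ₀ := by
  ext ⟨q, p⟩
  constructor
  · rintro ⟨hq, hp⟩
    obtain rfl : p = 0 := hp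
    exact ⟨q, hq, rfl⟩
  · rintro ⟨q', hq', h⟩
    rw [← h]
    exact ⟨hq', rfl⟩

theorem continuous_cotangent_zeroSection :
    Continuous (zeroSection (CoModel d) (fun q : M => TangentSpace (𝓡 d) q →L[ℝ] ℝ)) :=
  (contMDiff_zeroSection ℝ (fun q : M => TangentSpace (𝓡 d) q →L[ℝ] ℝ) (IB := 𝓡 d)
    (n := ∞)).continuous

end Transplant

/-! ### Choice of the exponent and conclusion -/

theorem exists_exponent {d d' : ℕ} {s : ℝ≥0} (hs : (d' + 1 < d ∧ s ≤ 1) ∨ (d' + 1 = d ∧ s < 1)) :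
    ∃ β : ℝ, d' + (s : ℝ) < β ∧ (d : ℝ) - 1 < β ∧ β < d := by
  have h : d' + (s : ℝ) < d := by
    rcases hs with ⟨h1, h2⟩ | ⟨h1, h2⟩
    · have h1' : (d' : ℝ) + 1 < d := by exact_mod_cast h1
      have h2' : (s : ℝ) ≤ 1 := h2
      linarith
    · have h1' : (d' : ℝ) + 1 = d := by exact_mod_cast h1
      have h2' : (s : ℝ) < 1 := h2
      linarith
  obtain ⟨β, h1, h2⟩ := exists_between (max_lt h (sub_one_lt (d : ℝ)))
  exact ⟨β, (le_max_left _ _).trans_lt h1, (le_max_right _ _).trans_lt h1, h2⟩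

end LagrangianGraphs

end

theorem theorem3 (d : ℕ) (hd : 2 ≤ d)
    (M : Type*) [TopologicalSpace M] [T2Space M] [CompactSpace M] [ConnectedSpace M]
    [ChartedSpace (EuclideanSpace ℝ (Fin d)) M] [IsManifold (𝓡 d) ∞ M]
    (d' : ℕ) (s : ℝ≥0) (hs : (d' + 1 < d ∧ s ≤ 1) ∨ (d' + 1 = d ∧ s < 1)) :
    ∃ (H : LagrangianGraphs.CotangentBundle d M → ℝ)
      (Γ : (q : M) → LagrangianGraphs.CotangentSpace d q)
      (Λ : Set (LagrangianGraphs.CotangentBundle d M)),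
      LagrangianGraphs.IsCkHolder (LagrangianGraphs.cotangentModel d) d' s H ∧
      ContMDiff (LagrangianGraphs.cotangentModel d) 𝓘(ℝ, ℝ) 1 H ∧
      LagrangianGraphs.IsLagrangianGraph Γ ∧
      IsCompact Λ ∧ IsConnected Λ ∧ Λ ⊆ LagrangianGraphs.graph Γ ∧
      LagrangianGraphs.IsInvariant H Λ ∧
      (3 ≤ d → LagrangianGraphs.ContainsItsOrbits H Λ) ∧
      (∃ x ∈ Λ, ∃ y ∈ Λ, H x ≠ H y) ∧
      (∀ q, Γ q = 0) ∧
      ∃ (g : LagrangianGraphs.SmoothMetric d M) (f : M → ℝ),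
        LagrangianGraphs.IsCkHolder (𝓡 d) d' s f ∧
        LagrangianGraphs.IsWhitneyNorton d f (TotalSpace.proj '' Λ) ∧
        ∀ x, H x = LagrangianGraphs.mechanicalHamiltonian g f x := by
  have hsle : s ≤ 1 := hs.elim (fun h => h.2) fun h => h.2.le
  have hd' : d' + 1 ≤ d := hs.elim (fun h => h.1.le) fun h => h.1.le
  have hdR : (2 : ℝ) ≤ d := by exact_mod_cast hd
  obtain ⟨β, hβ1, hβ2, hβ3⟩ := LagrangianGraphs.exists_exponent hs
  obtain ⟨K, F, hK, hKc, hF, hFsupp, hKnorm, hFcrit, hne⟩ :=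
    LagrangianGraphs.exists_whitney_function (by linarith : 1 < β) hβ3
  have hq : (0 : ℝ) ≤ 2 ^ (-β) := by positivity
  have hkq : (2 : ℝ) ^ d' * 2 ^ (s : ℝ) * 2 ^ (-β) < 1 := by
    rw [← Real.rpow_natCast, ← Real.rpow_add two_pos, ← Real.rpow_add two_pos]
    exact Real.rpow_lt_one_of_one_lt_of_neg one_lt_two (by linarith)
  -- The choice `d - 1 < β` makes `F` of class `C^1` in every case and of class `C^2` when `d ≥ 3`,
  -- independently of `d'` and `s`.
  have hFd : ContDiff ℝ (d - 1 : ℕ) F := by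
    refine hF.contDiff hq (by omega) ?_
    rw [← Real.rpow_natCast, ← Real.rpow_add two_pos]
    refine Real.rpow_lt_one_of_one_lt_of_neg one_lt_two ?_
    rw [Nat.cast_sub (by omega), Nat.cast_one]
    linarith
  have : Nontrivial (EuclideanSpace ℝ (Fin d)) :=
    Module.nontrivial_of_finrank_pos (R := ℝ) (by rw [finrank_euclideanSpace_fin]; omega)
  obtain ⟨f, Λ₀, hΛ, hΛc, hf, hfΛ, hfne⟩ := LagrangianGraphs.exists_isPullBackAt (M := M)
    (R := d * 4) (by positivity) hFsupp hK hKc hKnorm hne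
  have hfC : ∀ n : ℕ, n ≤ d - 1 → ContMDiff (𝓡 d) 𝓘(ℝ, ℝ) n f := fun n hn x =>
    (hf x).contMDiffAt (n := n) (hFd.of_le (WithTop.coe_le_coe.2 (Nat.cast_le.2 hn)))
  have hf1 : ContMDiff (𝓡 d) 𝓘(ℝ, ℝ) 1 f := by exact_mod_cast hfC 1 (by omega)
  have hcrit : ∀ q ∈ Λ₀, mfderiv (𝓡 d) 𝓘(ℝ, ℝ) f q = 0 := fun q hq =>
    (hfΛ q hq).mfderiv_eq_zero hFcrit
  obtain ⟨g⟩ := LagrangianGraphs.nonempty_smoothMetric (d := d) (M := M)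
  have himage := LagrangianGraphs.image_zeroSection (d := d) Λ₀
  have hproj : TotalSpace.proj ''
      {x : LagrangianGraphs.CotangentBundle d M | x.proj ∈ Λ₀ ∧ x.snd = 0} = Λ₀ := by
    ext q
    constructor
    · rintro ⟨x, hx, rfl⟩
      exact hx.1
    · intro hq
      exact ⟨⟨q, 0⟩, ⟨hq, rfl⟩, rfl⟩
  -- The Lagrangian graph is the zero section, with the zero function as primitive; `Λ` is its part
  -- over `Λ₀`.
  refine ⟨LagrangianGraphs.mechanicalHamiltonian g f, fun _ => 0,
    {x | x.proj ∈ Λ₀ ∧ x.snd = 0},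
    LagrangianGraphs.isCkHolder_mechanicalHamiltonian g hf hq hF hd' hsle hkq,
    LagrangianGraphs.contMDiff_mechanicalHamiltonian g (n := 1) hf1,
    fun _ => ⟨univ, isOpen_univ, mem_univ _, fun _ => 0, contMDiffOn_const,
      fun _ _ => mfderiv_const.symm⟩, ?_, ?_, fun x hx => hx.2,
    LagrangianGraphs.isInvariant_mechanicalHamiltonian g hf1 hcrit,
    fun h3 => LagrangianGraphs.containsItsOrbits_mechanicalHamiltonian g
      (by exact_mod_cast hfC 2 (by omega)) hcrit, ?_, fun _ => rfl, g, f,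
    LagrangianGraphs.isCkHolder_of_isPullBackAt hf hq hF hd' hsle hkq, ?_, fun _ => rfl⟩
  · rw [himage]
    exact hΛ.image LagrangianGraphs.continuous_cotangent_zeroSection
  · rw [himage]
    exact hΛc.image _ LagrangianGraphs.continuous_cotangent_zeroSection.continuousOn
  · obtain ⟨x, hx, y, hy, hxy⟩ := hfne
    refine ⟨⟨x, 0⟩, ⟨hx, rfl⟩, ⟨y, 0⟩, ⟨hy, rfl⟩, fun h => hxy ?_⟩
    have h0 : ∀ q : M, LagrangianGraphs.conormSq g q 0 = 0 := fun _ => rfl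
    simpa [LagrangianGraphs.mechanicalHamiltonian, h0] using h
  · rw [hproj]
    exact ⟨hf1, hΛ, hΛc, hcrit, hfne⟩
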